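/- **Notation.** For $n\in\mathbf Z_{\ge 1}$ let $\mathbf T^n=\{\underline z\in\mathbf C^n : |z_1|=\dots=|z_n|=1\}$, with probability Haar measure $\mu_n$. For a nonzero Laurent polynomial $P=\sum_{v\in\mathbf Z^n}c_v(P)\,\underline z^v\in\mathbf C[z_1^{\pm1},\dots,z_n^{\pm1}]$ let $m(P)=\int_{\mathbf T^n}\log|P|\,d\mu_n$ be its logarithmic Mahler measure, let $k(P)$ be the number of its nonzero coefficients, and let $\operatorname{diam}(P)$ be the smallest $d\in\mathbf N$ such that the Newton polytope of $P$ (the convex hull in $\mathbf R^n$ of $\{v : c_v(P)\ne 0\}$) is contained in a translate of $[0,d]^n$. Put $$\rho_0(P)=\max\{\operatorname{diam}(P)+1,\ 7\operatorname{diam}(P)^2,\ \exp(2(k(P)-1)\max(n,5))\}.$$ For a matrix $A=(a_{i,j})\in\mathbf Z^{m\times n}$ let $P_A(z_1,\dots,z_m)=P(z_1^{a_{1,1}}\cdots z_m^{a_{m,1}},\ \dots,\ z_1^{a_{1,n}}\cdots z_m^{a_{m,n}})$, and let $$\rho(A)=\min\{\|v\|_\infty : v\in\mathbf Z^n\setminus\{0\},\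 Av=0\},$$ with $\rho(A)=+\infty$ if there is no such $v$. **Theorem.** Let $k,n\ge 2$ be integers, and let $P\in\mathbf C[z_1^{\pm1},\dots,z_n^{\pm1}]$ be a Laurent polynomial with exactly $k$ nonzero coefficients. Then, for every integer $m\ge1$ and every matrix $A\in\mathbf Z^{m\times n}$ with $\rho(A)\ge\rho_0(P)$, the polynomial $P_A$ is nonzero, the integrals defining $m(P)$ and $m(P_A)$ converge absolutely, and $$|m(P_A)-m(P)|\ \le\ 8\cdot(36ek)^{n-1}\cdot\log(\rho(A))^{n}\cdot\left(\frac{\operatorname{diam}(P)}{\rho(A)}\right)^{\frac1{k-1}},$$ where for $\rho(A)=+\infty$ the right-hand side is read as its limit $0$, that is, $m(P_A)=m(P)$. -/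

import Mathlib

open MeasureTheory

namespace MahlerSubst

noncomputable section

/-- Laurent polynomials `ℂ[z₁^{±1}, …, zₙ^{±1}]`: the group algebra of `ℤⁿ` over `ℂ`. The coefficient
of the monomial `z^v` in `P` is `P.coeff v`. -/
abbrev Laurent (n : ℕ) : Type := AddMonoidAlgebra ℂ (Fin n → ℤ)

variable {m n : ℕ}

/-- The value `z^v = z₁^{v₁} ⋯ zₙ^{vₙ}` of a Laurent monomial. -/
def monomialValue (z : Fin n → ℂ) (v : Fin n → ℤ) : ℂ := ∏ j, z j ^ v j

/-- The value `P(z) = ∑_v c_v(P) z^v`, for `z` in `(ℂˣ)ⁿ`. -/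
def eval (P : Laurent n) (z : Fin n → ℂ) : ℂ :=
  P.coeff.sum fun v c => c * monomialValue z v

/-- The monomial substitution
`z^A = (z₁^{a₁₁} ⋯ z_m^{a_{m1}}, …, z₁^{a_{1n}} ⋯ z_m^{a_{mn}})`. -/
def powMatrix (z : Fin m → ℂ) (A : Matrix (Fin m) (Fin n) ℤ) : Fin n → ℂ :=
  fun j => ∏ i, z i ^ A i j

/-- The Laurent polynomial `P_A`, which satisfies `P_A(z) = P(z^A)` (`eval_subst` below):
the substitution sends the monomial `z^v` to `z^{A v}`, and coefficients of coinciding monomials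
are added. -/
def subst (P : Laurent n) (A : Matrix (Fin m) (Fin n) ℤ) : Laurent m :=
  AddMonoidAlgebra.mapDomain (fun v => A.mulVec v) P

theorem monomialValue_powMatrix (z : Fin m → ℂ) (hz : ∀ i, z i ≠ 0)
    (A : Matrix (Fin m) (Fin n) ℤ) (v : Fin n → ℤ) :
    monomialValue (powMatrix z A) v = monomialValue z (A.mulVec v) := by
  unfold monomialValue powMatrix
  have h : ∀ i, z i ^ (A.mulVec v) i = ∏ j, (z i ^ A i j) ^ v j := by
    intro i
    have hs : ∀ s : Finset (Fin n),
        z i ^ (∑ j ∈ s, A i j * v j) = ∏ j ∈ s, (z i ^ A i j) ^ v j := by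
      intro s
      induction s using Finset.induction_on with
      | empty => simp
      | insert a s ha ih =>
        rw [Finset.sum_insert ha, Finset.prod_insert ha, zpow_add₀ (hz i), ih, zpow_mul]
    exact hs Finset.univ
  calc ∏ j, (∏ i, z i ^ A i j) ^ v j = ∏ j, ∏ i, (z i ^ A i j) ^ v j :=
        Finset.prod_congr rfl fun j _ => (Finset.prod_zpow _ _ _).symm
    _ = ∏ i, ∏ j, (z i ^ A i j) ^ v j := Finset.prod_comm
    _ = ∏ i, z i ^ (A.mulVec v) i := Finset.prod_congr rfl fun i _ => (h i).symm

theorem eval_subst (P : Laurent n) (A : Matrix (Fin m) (Fin n) ℤ) (z : Fin m → ℂ)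
    (hz : ∀ i, z i ≠ 0) : eval (subst P A) z = eval P (powMatrix z A) := by
  unfold eval subst
  rw [AddMonoidAlgebra.coeff_mapDomain, Finsupp.sum_mapDomain_index]
  · simp_rw [monomialValue_powMatrix z hz]
  · intro v
    simp
  · intro v c d
    ring

/-- The point `(e^{2πi x₁}, …, e^{2πi xₙ})` of the unit torus `𝕋ⁿ ⊆ ℂⁿ`, for `x` in `(ℝ/ℤ)ⁿ`. This
identifies `(ℝ/ℤ)ⁿ`, with its Lebesgue (Haar) measure of total mass `1`, with `𝕋ⁿ` and its
probability Haar measure. -/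
def torusPoint (x : UnitAddTorus (Fin n)) : Fin n → ℂ := fun j => (AddCircle.toCircle (x j) : ℂ)

/-- The function `log |P|` on the unit torus. -/
def logAbs (P : Laurent n) (x : UnitAddTorus (Fin n)) : ℝ := Real.log ‖eval P (torusPoint x)‖

/-- The logarithmic Mahler measure `m(P) = ∫_{𝕋ⁿ} log |P| dμₙ`. -/
def mahler (P : Laurent n) : ℝ := ∫ x : UnitAddTorus (Fin n), logAbs P x

/-- The number `k(P)` of nonzero coefficients of `P`. -/
def numCoeffs (P : Laurent n) : ℕ := P.coeff.support.card

/-- The Newton polytope of `P`: the convex hull in `ℝⁿ` of the support of `P`. -/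
def newtonPolytope (P : Laurent n) : Set (Fin n → ℝ) :=
  convexHull ℝ ((fun (v : Fin n → ℤ) (j : Fin n) => (v j : ℝ)) '' (P.coeff.support : Set (Fin n → ℤ)))

/-- The diameter of `P`: the smallest natural number `d` such that the Newton polytope is contained
in a translate `b + [0,d]ⁿ` of the cube `[0,d]ⁿ`. -/
def diam (P : Laurent n) : ℕ :=
  sInf {d : ℕ | ∃ b : Fin n → ℝ, newtonPolytope P ⊆ Set.Icc b (fun j => b j + (d : ℝ))}

/-- `ρ(A)`: the least sup norm of a nonzero integer vector in the kernel of `A`, equal to `∞` if there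
is no such vector. (The norm of `Fin n → ℤ` in Mathlib is the sup norm.) -/
def rho (A : Matrix (Fin m) (Fin n) ℤ) : ENNReal :=
  ⨅ v ∈ {v : Fin n → ℤ | v ≠ 0 ∧ A.mulVec v = 0}, ENNReal.ofReal ‖v‖

/-- `ρ₀(P) = max {diam(P) + 1, 7 diam(P)², exp(2 (k(P) - 1) max(n, 5))}`. -/
def rhoZero (P : Laurent n) : ℝ :=
  max ((diam P : ℝ) + 1)
    (max (7 * (diam P : ℝ) ^ 2) (Real.exp (2 * ((numCoeffs P : ℝ) - 1) * max (n : ℝ) 5)))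

end

end MahlerSubst

/-!
Let `R` be a lower bound for the norms of the nonzero integral vectors in the kernel of `A`. If `Q` is
a real polynomial of degree `N` with `N diam(P) < R`, expanding `Q(|P| ^ 2)` in monomials shows that it
has the same integral as `Q(|P_A| ^ 2)`, since no monomial other than `1` becomes constant under the
substitution (`integral_polynomial_norm_sq_subst`). It remains to approximate `log |P|` by such
polynomials, for `P` and for `P_A`, which has the same coefficients. This takes two steps.

* `log |P|` is replaced by `log (|P| ^ 2 + ε ^ 2) / 2`. The error is an integral over the set where `|P|`
  is small, and `volume_norm_eval_lt` bounds the measure of this set: a Laurent polynomial with `k + 1`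
  nonzero coefficients is smaller than `s` times one of them only on a set of measure `5 k s ^ (1 / k)`,
  whatever the number of variables.
* `log (u + ε ^ 2) / 2` is approximated by its truncated Chebyshev expansion
  (`exists_polynomial_approx_log`). The error decreases exponentially in `N ε`, so that `ε` can be taken
  of order `diam(P) log R / R`.

The measure bound reduces to one variable by slicing the torus along lines in a direction that
separates the monomials. For exponential sums (`volume_norm_expSum_lt`) it is proved by induction on the
number of terms: dividing by an extreme monomial and differentiating removes one term, and where the
derivative is not small the logarithmic derivative is large. The latter happens rarely, by
Kolmogorov's weak-type inequality (`volume_le_norm_of_re_nonneg`) applied to the partial fraction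
expansion of the logarithmic derivative, with the roots inside and outside the disc treated separately.

The resulting estimate `33 (k - 1) (log R) ^ 2 (diam(P) / R) ^ (1 / (k - 1))`, where `k` is now the number
of coefficients of `P`, is at most the stated one.
-/

open Filter Topology

/-! ### A weak-type inequality for the logarithmic derivative on the unit circle -/


instance : IsProbabilityMeasure (volume : Measure UnitAddCircle) := ⟨by simp⟩

/-- The mean value property on circles of radius `r < 1`, in terms of `ℝ/ℤ`. -/
theorem integral_toCircle_eq_of_differentiableOn {G : ℂ → ℂ}
    (hG : DifferentiableOn ℂ G (Metric.ball 0 1)) {r : ℝ} (hr0 : 0 < r) (hr1 : r < 1) :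
    ∫ t : UnitAddCircle, G (r * (AddCircle.toCircle t : ℂ)) = G 0 := by
  have hsub : Metric.closedBall (0 : ℂ) |r| ⊆ Metric.ball 0 1 := by
    rw [abs_of_pos hr0]
    exact Metric.closedBall_subset_ball hr1
  have hd : DiffContOnCl ℂ G (Metric.ball 0 |r|) :=
    (hG.mono hsub).diffContOnCl_ball (subset_refl _)
  have h1 := hd.circleAverage
  rw [Real.circleAverage_def] at h1
  rw [← UnitAddCircle.intervalIntegral_preimage 0, ← h1]
  have h2 := intervalIntegral.smul_integral_comp_mul_left
    (a := (0 : ℝ)) (b := 1) (fun θ => G (circleMap 0 r θ)) (2 * Real.pi)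
  rw [mul_zero, mul_one] at h2
  rw [← h2, smul_smul, inv_mul_cancel₀ (by positivity), one_smul, zero_add]
  refine intervalIntegral.integral_congr fun t _ => ?_
  simp only [circleMap, zero_add, AddCircle.toCircle_apply_mk, Circle.coe_exp]
  congr 4
  simp

/-- Kolmogorov's weak-type inequality: a function of nonnegative real part, holomorphic in the
disc, with value `N` at the centre, is at least `l` in modulus only on a boundary set of measure
at most `2 N / l`. The proof averages `Re (l / (F + l))`, which lies in `[0, 1]` and is at most
`1/2` where `|F| ≥ l`. -/
theorem volume_le_norm_of_re_nonneg {F : ℂ → ℂ} {N l : ℝ} (hl : 0 < l)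
    (hF : DifferentiableOn ℂ F (Metric.ball 0 1)) (hre : ∀ z ∈ Metric.ball (0 : ℂ) 1, 0 ≤ (F z).re)
    (h0 : F 0 = N)
    (hlim : ∀ᵐ t : UnitAddCircle, ContinuousAt F (AddCircle.toCircle t : ℂ)) :
    volume {t : UnitAddCircle | l ≤ ‖F (AddCircle.toCircle t : ℂ)‖} ≤ ENNReal.ofReal (2 * N / l) := by
  have hN : 0 ≤ N := by simpa [h0] using hre 0 (by simp)
  have hne : ∀ w : ℂ, 0 ≤ w.re → w + l ≠ 0 := by
    intro w hw h
    have := congrArg Complex.re h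
    simp at this
    linarith
  set J : ℂ → ℂ := fun z => l / (F z + l) with hJ
  have hJd : DifferentiableOn ℂ J (Metric.ball 0 1) :=
    (differentiableOn_const _).div (hF.add (differentiableOn_const _)) fun z hz => hne _ (hre z hz)
  have hJn : ∀ w : ℂ, 0 ≤ w.re → ‖(l : ℂ) / (w + l)‖ ≤ 1 := by
    intro w hw
    rw [norm_div, div_le_one (norm_pos_iff.2 (hne w hw)), Complex.norm_real, Real.norm_of_nonneg hl.le]
    calc l ≤ (w + l).re := by simpa using hw
      _ ≤ _ := Complex.re_le_norm _
  -- radii increasing to `1`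
  let r : ℕ → ℝ := fun n => 1 - 1 / ((n : ℝ) + 2)
  have hr0 : ∀ n, 0 < r n := fun n => by
    have : (1 : ℝ) / ((n : ℝ) + 2) < 1 := by
      rw [div_lt_one (by positivity)]; have : (0 : ℝ) ≤ n := n.cast_nonneg
      linarith
    simp only [r]; linarith
  have hr1 : ∀ n, r n < 1 := fun n => by
    have : (0 : ℝ) < 1 / ((n : ℝ) + 2) := by positivity
    simp only [r]; linarith
  have hrlim : Tendsto r atTop (𝓝 1) := by
    have : Tendsto (fun n : ℕ => 1 / ((n : ℝ) + 2)) atTop (𝓝 0) :=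
      tendsto_const_nhds.div_atTop (tendsto_atTop_add_const_right _ _ tendsto_natCast_atTop_atTop)
    simpa [r] using tendsto_const_nhds.sub this
  have hmem : ∀ n (t : UnitAddCircle), (r n : ℂ) * (AddCircle.toCircle t : ℂ) ∈ Metric.ball (0 : ℂ) 1 := by
    intro n t
    rw [mem_ball_zero_iff, norm_mul, Circle.norm_coe, mul_one, Complex.norm_real,
      Real.norm_of_nonneg (hr0 n).le]
    exact hr1 n
  have hpt : ∀ t : UnitAddCircle, Tendsto (fun n => (r n : ℂ) * (AddCircle.toCircle t : ℂ)) atTop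
      (𝓝 (AddCircle.toCircle t : ℂ)) := by
    intro t
    have : Tendsto (fun n => (r n : ℂ)) atTop (𝓝 ((1 : ℝ) : ℂ)) :=
      (Complex.continuous_ofReal.tendsto _).comp hrlim
    simpa using this.mul_const (AddCircle.toCircle t : ℂ)
  have hbd : ∀ᵐ t : UnitAddCircle, Tendsto (fun n => F ((r n : ℂ) * (AddCircle.toCircle t : ℂ))) atTop
      (𝓝 (F (AddCircle.toCircle t : ℂ))) := by
    filter_upwards [hlim] with t ht using ht.tendsto.comp (hpt t)
  have hbre : ∀ᵐ t : UnitAddCircle, 0 ≤ (F (AddCircle.toCircle t : ℂ)).re := by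
    filter_upwards [hbd] with t ht
    exact ge_of_tendsto' ((Complex.continuous_re.tendsto _).comp ht) fun n => hre _ (hmem n t)
  have hJlim : ∀ᵐ t : UnitAddCircle, Tendsto (fun n => J ((r n : ℂ) * (AddCircle.toCircle t : ℂ))) atTop
      (𝓝 (J (AddCircle.toCircle t : ℂ))) := by
    filter_upwards [hbd, hbre] with t ht ht'
    exact tendsto_const_nhds.div (ht.add_const _) (hne _ ht')
  have hmeas : ∀ n, AEStronglyMeasurable
      (fun t : UnitAddCircle => J ((r n : ℂ) * (AddCircle.toCircle t : ℂ))) volume := by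
    intro n
    refine Continuous.aestronglyMeasurable ?_
    refine hJd.continuousOn.comp_continuous ?_ (hmem n)
    fun_prop
  have hint : ∫ t : UnitAddCircle, J (AddCircle.toCircle t : ℂ) = J 0 := by
    have h1 := tendsto_integral_of_dominated_convergence (fun _ : UnitAddCircle => (1 : ℝ)) hmeas
      (integrable_const _) (fun n => Eventually.of_forall fun t => hJn _ (hre _ (hmem n t))) hJlim
    refine tendsto_nhds_unique h1 ?_
    simp_rw [integral_toCircle_eq_of_differentiableOn hJd (hr0 _) (hr1 _)]
    exact tendsto_const_nhds
  have hJae : AEStronglyMeasurable (fun t : UnitAddCircle => J (AddCircle.toCircle t : ℂ)) volume :=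
    aestronglyMeasurable_of_tendsto_ae _ hmeas hJlim
  have hJi : Integrable (fun t : UnitAddCircle => J (AddCircle.toCircle t : ℂ)) volume :=
    Integrable.of_bound hJae 1 (by filter_upwards [hbre] with t ht using hJn _ ht)
  set g : UnitAddCircle → ℝ := fun t => 1 - (J (AddCircle.toCircle t : ℂ)).re with hg
  have hgi : Integrable g volume := (integrable_const _).sub hJi.re
  have hgint : ∫ t, g t = N / (N + l) := by
    have h1 : ∫ t : UnitAddCircle, (J (AddCircle.toCircle t : ℂ)).re = (J 0).re := by
      rw [← hint]; exact integral_re hJi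
    have h2 : J 0 = ((l / (N + l) : ℝ) : ℂ) := by simp [hJ, h0]
    have h3 := integral_sub (integrable_const (1 : ℝ)) hJi.re
    simp only [RCLike.re_eq_complex_re, h1] at h3
    simp only [hg, h3, h2, Complex.ofReal_re, integral_const, probReal_univ, smul_eq_mul]
    field_simp
    ring
  have hg0 : 0 ≤ᵐ[volume] g := by
    filter_upwards [hbre] with t ht
    have := (Complex.re_le_norm (J (AddCircle.toCircle t : ℂ))).trans (hJn _ ht)
    simp only [hg, Pi.zero_apply]
    linarith
  have hsub : {t : UnitAddCircle | l ≤ ‖F (AddCircle.toCircle t : ℂ)‖} ≤ᵐ[volume] {t | 1 / 2 ≤ g t} := by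
    filter_upwards [hbre] with t ht ht'
    change l ≤ _ at ht'
    change 1 / 2 ≤ g t
    set w := F (AddCircle.toCircle t : ℂ) with hw
    have h1 : (l / (w + l) : ℂ).re = l * (w.re + l) / ((w.re + l) ^ 2 + w.im ^ 2) := by
      rw [Complex.div_re, Complex.normSq_apply]
      simp
      ring
    have h2 : l ^ 2 ≤ w.re ^ 2 + w.im ^ 2 := by
      have := Complex.sq_norm w
      rw [Complex.normSq_apply] at this
      nlinarith
    have h3 : (0 : ℝ) < (w.re + l) ^ 2 + w.im ^ 2 := by positivity
    simp only [hg, hJ, ← hw, h1]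
    rw [le_sub_comm, div_le_iff₀ h3]
    nlinarith
  refine (measure_mono_ae hsub).trans ?_
  have hmk := mul_meas_ge_le_integral_of_nonneg hg0 hgi (1 / 2)
  rw [hgint] at hmk
  have : volume.real {t | 1 / 2 ≤ g t} ≤ 2 * N / l := by
    have h4 : N / (N + l) ≤ N / l := div_le_div_of_nonneg_left hN hl (by linarith)
    have h5 : 2 * N / l = 2 * (N / l) := by ring
    rw [h5]; linarith
  rw [← ofReal_measureReal]
  exact ENNReal.ofReal_le_ofReal this

instance : Nontrivial UnitAddCircle where
  exists_pair_ne := by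
    refine ⟨0, ((1 / 2 : ℝ) : UnitAddCircle), fun h => ?_⟩
    have h1 := congrArg (fun t : UnitAddCircle => (AddCircle.toCircle t : ℂ)) h
    simp only [AddCircle.toCircle_zero, AddCircle.toCircle_apply_mk, Circle.coe_exp,
      Circle.coe_one] at h1
    have h2 : ((2 * Real.pi / 1 * (1 / 2) : ℝ) : ℂ) = Real.pi := by push_cast; ring
    rw [h2, Complex.exp_pi_mul_I] at h1
    norm_num at h1

theorem ae_toCircle_ne (w : ℂ) : ∀ᵐ t : UnitAddCircle, (AddCircle.toCircle t : ℂ) ≠ w := by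
  have : {t : UnitAddCircle | (AddCircle.toCircle t : ℂ) = w}.Subsingleton := by
    intro s hs t ht
    exact AddCircle.injective_toCircle one_ne_zero (Circle.ext (hs.trans ht.symm))
  rw [ae_iff]
  simpa using this.measure_zero volume

/-- The weak-type inequality for a sum of Cayley transforms. -/
theorem volume_le_norm_sum_cayley (W : Multiset ℂ) (hW : ∀ w ∈ W, ‖w‖ ≤ 1) {l : ℝ} (hl : 0 < l) :
    volume {t : UnitAddCircle |
        l ≤ ‖(W.map fun w => (1 + w * (AddCircle.toCircle t : ℂ)) /
          (1 - w * (AddCircle.toCircle t : ℂ))).sum‖} ≤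
      ENNReal.ofReal (2 * (Multiset.card W : ℝ) / l) := by
  have hne : ∀ w ∈ W, ∀ z ∈ Metric.ball (0 : ℂ) 1, 1 - w * z ≠ 0 := by
    intro w hw z hz h
    have h1 : ‖w * z‖ = 1 := by rw [← sub_eq_zero.1 h, norm_one]
    rw [norm_mul] at h1
    have := mem_ball_zero_iff.1 hz
    nlinarith [hW w hw, norm_nonneg w, norm_nonneg z]
  refine volume_le_norm_of_re_nonneg
    (F := fun z => (W.map fun w => (1 + w * z) / (1 - w * z)).sum) hl ?_ ?_ ?_ ?_
  · intro z hz
    induction W using Multiset.induction_on with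
    | empty => simpa using differentiableWithinAt_const _
    | cons a W ih =>
      simp only [Multiset.map_cons, Multiset.sum_cons]
      refine DifferentiableWithinAt.add ?_ (ih (fun w hw => hW w (Multiset.mem_cons_of_mem hw))
        (fun w hw => hne w (Multiset.mem_cons_of_mem hw)))
      have := hne a (Multiset.mem_cons_self a W) z hz
      fun_prop (disch := assumption)
  · intro z hz
    have : ∀ w ∈ W, 0 ≤ ((1 + w * z) / (1 - w * z)).re := by
      intro w hw
      have h1 := hne w hw z hz
      have h2 : ‖w * z‖ ≤ 1 := by
        rw [norm_mul]
        have := mem_ball_zero_iff.1 hz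
        nlinarith [hW w hw, norm_nonneg w, norm_nonneg z]
      set u := w * z with hu
      have h3 : u.re ^ 2 + u.im ^ 2 ≤ 1 := by
        have := Complex.sq_norm u
        rw [Complex.normSq_apply] at this
        nlinarith [norm_nonneg u]
      rw [Complex.div_re, ← add_div]
      refine div_nonneg ?_ (Complex.normSq_nonneg _)
      simp
      nlinarith
    have h4 := Multiset.sum_nonneg (s := W.map fun w => ((1 + w * z) / (1 - w * z)).re)
      (by simpa using this)
    calc (0 : ℝ) ≤ _ := h4
      _ = _ := by
        have := map_multiset_sum Complex.reAddGroupHom (W.map fun w => (1 + w * z) / (1 - w * z))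
        rw [Multiset.map_map] at this
        exact this.symm
  · simp
  · have h1 : ∀ᵐ t : UnitAddCircle, ∀ w ∈ W.toFinset, (AddCircle.toCircle t : ℂ) ≠ w⁻¹ :=
      (ae_ball_iff (Finset.countable_toSet _)).2 fun w _ => ae_toCircle_ne _
    filter_upwards [h1] with t ht
    have h2 : ∀ w ∈ W, 1 - w * (AddCircle.toCircle t : ℂ) ≠ 0 := by
      intro w hw h
      refine ht w (Multiset.mem_toFinset.2 hw) ?_
      rw [sub_eq_zero] at h
      exact eq_inv_of_mul_eq_one_right h.symm
    clear h1 ht hne hW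
    induction W using Multiset.induction_on with
    | empty => simpa using continuousAt_const
    | cons a W ih =>
      simp only [Multiset.map_cons, Multiset.sum_cons]
      refine ContinuousAt.add ?_ (ih (fun w hw => h2 w (Multiset.mem_cons_of_mem hw)))
      have := h2 a (Multiset.mem_cons_self a W)
      fun_prop (disch := assumption)

/-- The weak-type inequality for the logarithmic derivative of a polynomial of degree `D`. On the
unit circle, `z p' / p - D / 2` is half a difference of two sums of Cayley transforms: the roots `w`
in the closed disc give `(1 + w z⁻¹) / (1 - w z⁻¹)`, the other roots give `(1 + w⁻¹ z) / (1 - w⁻¹ z)`. -/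
theorem volume_le_norm_derivative {p : Polynomial ℂ} (hp : p ≠ 0) {l : ℝ} (hl : 0 < l) :
    volume {t : UnitAddCircle | l * ‖p.eval (AddCircle.toCircle t : ℂ)‖ ≤
        ‖(AddCircle.toCircle t : ℂ) * p.derivative.eval (AddCircle.toCircle t : ℂ) -
          (p.natDegree : ℂ) / 2 * p.eval (AddCircle.toCircle t : ℂ)‖} ≤
      ENNReal.ofReal (2 * p.natDegree / l) := by
  have hs : p.Splits := IsAlgClosed.splits p
  set W₁ := p.roots.filter (fun w => ‖w‖ ≤ 1) with hW₁
  set W₂ := p.roots.filter (fun w => ¬ ‖w‖ ≤ 1) with hW₂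
  have hW : W₁ + W₂ = p.roots := Multiset.filter_add_not _ _
  have hcard : ((Multiset.card W₁ : ℝ) + Multiset.card W₂) = p.natDegree := by
    rw [hs.natDegree_eq_card_roots, ← hW]; push_cast [Multiset.card_add]; ring
  set F₁ : UnitAddCircle → ℂ := fun t => (W₁.map fun w => (1 + w * (AddCircle.toCircle t : ℂ)) /
          (1 - w * (AddCircle.toCircle t : ℂ))).sum with hF₁
  set F₂ : UnitAddCircle → ℂ := fun t => ((W₂.map (·⁻¹)).map fun w =>
    (1 + w * (AddCircle.toCircle t : ℂ)) / (1 - w * (AddCircle.toCircle t : ℂ))).sum with hF₂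
  have key : ∀ t : UnitAddCircle, p.eval (AddCircle.toCircle t : ℂ) ≠ 0 →
      2 * ((AddCircle.toCircle t : ℂ) * p.derivative.eval (AddCircle.toCircle t : ℂ) -
          (p.natDegree : ℂ) / 2 * p.eval (AddCircle.toCircle t : ℂ)) =
        (F₁ (-t) - F₂ t) * p.eval (AddCircle.toCircle t : ℂ) := by
    intro t ht
    have hld := hs.eval_derivative_div_eval_of_ne_zero ht
    have hz0 := Circle.coe_ne_zero (AddCircle.toCircle t)
    have hzi : ((AddCircle.toCircle (-t) : Circle) : ℂ) = (AddCircle.toCircle t : ℂ)⁻¹ := by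
      rw [AddCircle.toCircle_neg, Circle.coe_inv]
    simp only [hF₁, hF₂, hzi]
    set z := (AddCircle.toCircle t : ℂ) with hz
    have hne : ∀ w ∈ p.roots, z - w ≠ 0 := by
      intro w hw h
      rw [sub_eq_zero] at h
      exact ht (h ▸ (Polynomial.mem_roots hp).1 hw)
    have h1 : (W₁.map fun w => (1 + w * z⁻¹) / (1 - w * z⁻¹)).sum =
        (W₁.map fun w => 2 * z * (1 / (z - w)) - 1).sum := by
      refine congrArg _ (Multiset.map_congr rfl fun w hw => ?_)
      have := hne w (hW ▸ Multiset.mem_add.2 (Or.inl hw))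
      have h2 : 1 - w * z⁻¹ ≠ 0 := by
        intro h
        apply this
        field_simp at h
        simpa using h
      field_simp
      ring
    have h2 : ((W₂.map (·⁻¹)).map fun w => (1 + w * z) / (1 - w * z)).sum =
        (W₂.map fun w => -(2 * z * (1 / (z - w)) - 1)).sum := by
      rw [Multiset.map_map]
      refine congrArg _ (Multiset.map_congr rfl fun w hw => ?_)
      have h3 := hne w (hW ▸ Multiset.mem_add.2 (Or.inr hw))
      have h4 : w ≠ 0 := by
        rintro rfl
        simpa using (Multiset.mem_filter.1 hw).2
      have h5 : 1 - w⁻¹ * z ≠ 0 := by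
        intro h
        apply h3
        field_simp at h
        linear_combination -h
      have h6 : w - z ≠ 0 := by
        intro h
        exact h3 (by linear_combination -h)
      simp only [Function.comp]
      have e1 : (1 + w⁻¹ * z) / (1 - w⁻¹ * z) = (w + z) / (w - z) := by
        field_simp
      have e2 : z - w = -(w - z) := by ring
      rw [e1, e2]
      field_simp
      ring
    rw [h1, h2, Multiset.sum_map_neg, sub_neg_eq_add, ← Multiset.sum_add, ← Multiset.map_add, hW,
      Multiset.sum_map_sub, Multiset.sum_map_mul_left, ← hld]
    simp only [Multiset.map_const', Multiset.sum_replicate, nsmul_eq_mul, mul_one,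
      ← hs.natDegree_eq_card_roots]
    field_simp
  have hroots : ∀ᵐ t : UnitAddCircle, p.eval (AddCircle.toCircle t : ℂ) ≠ 0 := by
    have h1 : ∀ᵐ t : UnitAddCircle, ∀ w ∈ p.roots.toFinset, (AddCircle.toCircle t : ℂ) ≠ w :=
      (ae_ball_iff (Finset.countable_toSet _)).2 fun w _ => ae_toCircle_ne _
    filter_upwards [h1] with t ht h
    exact ht _ (Multiset.mem_toFinset.2 ((Polynomial.mem_roots hp).2 h)) rfl
  have hsub : {t : UnitAddCircle | l * ‖p.eval (AddCircle.toCircle t : ℂ)‖ ≤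
        ‖(AddCircle.toCircle t : ℂ) * p.derivative.eval (AddCircle.toCircle t : ℂ) -
          (p.natDegree : ℂ) / 2 * p.eval (AddCircle.toCircle t : ℂ)‖} ≤ᵐ[volume]
      ((fun t => -t) ⁻¹' {t | l ≤ ‖F₁ t‖} ∪ {t | l ≤ ‖F₂ t‖} : Set UnitAddCircle) := by
    filter_upwards [hroots] with t ht ht'
    change l * _ ≤ _ at ht'
    have h1 := congrArg norm (key t ht)
    rw [norm_mul, norm_mul, Complex.norm_ofNat] at h1
    have h2 : 2 * l ≤ ‖F₁ (-t) - F₂ t‖ := by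
      refine le_of_mul_le_mul_right ?_ (norm_pos_iff.2 ht)
      linarith
    have h3 := norm_sub_le (F₁ (-t)) (F₂ t)
    by_contra hcon
    have hcon' : ¬ (l ≤ ‖F₁ (-t)‖ ∨ l ≤ ‖F₂ t‖) := hcon
    push Not at hcon'
    linarith [hcon'.1, hcon'.2]
  refine (measure_mono_ae hsub).trans ((measure_union_le _ _).trans ?_)
  rw [Measure.measure_preimage_neg]
  have b1 := volume_le_norm_sum_cayley W₁ (fun w hw => (Multiset.mem_filter.1 hw).2) hl
  have b2 := volume_le_norm_sum_cayley (W₂.map (·⁻¹)) (by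
    intro w hw
    obtain ⟨v, hv, rfl⟩ := Multiset.mem_map.1 hw
    rw [norm_inv]
    exact inv_le_one_of_one_le₀ (not_le.1 (Multiset.mem_filter.1 hv).2).le) hl
  refine (add_le_add b1 b2).trans ?_
  rw [← ENNReal.ofReal_add (by positivity) (by positivity), Multiset.card_map, ← hcard]
  exact ENNReal.ofReal_le_ofReal (le_of_eq (by ring))

/-! ### Small values of exponential sums -/

theorem fourier_eq_zpow (n : ℤ) (t : UnitAddCircle) :
    fourier n t = (AddCircle.toCircle t : ℂ) ^ n := by
  rw [fourier_apply, AddCircle.toCircle_zsmul, Circle.coe_zpow]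

/-- An exponential sum with extreme frequencies `a lo` and `a hi` is rarely much smaller than the
sum obtained by dividing it by one of the two extreme monomials and differentiating. That quotient
has logarithmic derivative `z p' / p` or `z p' / p - D`, with `p` of degree `D = a hi - a lo`; both
lie at distance `D / 2` from the expression bounded in `volume_le_norm_derivative`. -/
theorem volume_le_norm_expSum_derivative {ι : Type*} (S : Finset ι) (a : ι → ℤ) (c : ι → ℂ)
    (ha : Set.InjOn a S) (hc : ∀ i ∈ S, c i ≠ 0) {lo hi i : ι} (hlo : lo ∈ S) (hhi : hi ∈ S)
    (hmin : ∀ j ∈ S, a lo ≤ a j) (hmax : ∀ j ∈ S, a j ≤ a hi) (hi' : i = lo ∨ i = hi)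
    {l : ℝ} (hl : ((a hi : ℝ) - a lo) / 2 < l) :
    volume {t : UnitAddCircle | l * ‖∑ j ∈ S, c j * fourier (a j) t‖ ≤
        ‖∑ j ∈ S, ((a j - a i : ℤ) : ℂ) * c j * fourier (a j) t‖} ≤
      ENNReal.ofReal (2 * ((a hi : ℝ) - a lo) / (l - ((a hi : ℝ) - a lo) / 2)) := by
  classical
  set D : ℕ := (a hi - a lo).toNat with hD
  have hDz : (D : ℤ) = a hi - a lo := Int.toNat_of_nonneg (sub_nonneg.2 (hmin _ hhi))
  have hDr : (D : ℝ) = (a hi : ℝ) - a lo := by exact_mod_cast hDz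
  set e : ι → ℕ := fun j => (a j - a lo).toNat with he
  have hez : ∀ j ∈ S, (e j : ℤ) = a j - a lo := fun j hj =>
    Int.toNat_of_nonneg (sub_nonneg.2 (hmin _ hj))
  set p : Polynomial ℂ := ∑ j ∈ S, Polynomial.C (c j) * Polynomial.X ^ e j with hp
  have hcoeff : p.coeff D = c hi := by
    rw [hp, Polynomial.finsetSum_coeff, Finset.sum_eq_single hi]
    · rw [Polynomial.coeff_C_mul_X_pow, if_pos rfl]
    · intro j hj hne
      rw [Polynomial.coeff_C_mul_X_pow, if_neg]
      intro h
      apply hne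
      apply ha hj hhi
      have h1 := hez j hj
      rw [← h, hDz] at h1
      linarith
    · exact fun h => absurd hhi h
  have hdeg : p.natDegree = D := by
    refine Polynomial.natDegree_eq_of_le_of_coeff_ne_zero ?_ (hcoeff ▸ hc hi hhi)
    refine Polynomial.natDegree_sum_le_of_forall_le _ _ fun j hj => ?_
    refine (Polynomial.natDegree_C_mul_X_pow_le _ _).trans ?_
    have h1 := hez j hj
    have h2 := hmax j hj
    omega
  have hp0 : p ≠ 0 := fun h => hc hi hhi (by rw [← hcoeff, h, Polynomial.coeff_zero])
  have hz0 : ∀ t : UnitAddCircle, (AddCircle.toCircle t : ℂ) ≠ 0 := fun t => Circle.coe_ne_zero _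
  have heval : ∀ t : UnitAddCircle, (AddCircle.toCircle t : ℂ) ^ (a lo) * p.eval (AddCircle.toCircle t : ℂ) =
      ∑ j ∈ S, c j * fourier (a j) t := by
    intro t
    rw [hp, Polynomial.eval_finsetSum, Finset.mul_sum]
    refine Finset.sum_congr rfl fun j hj => ?_
    rw [fourier_eq_zpow, Polynomial.eval_mul, Polynomial.eval_C, Polynomial.eval_pow,
      Polynomial.eval_X, ← zpow_natCast, hez j hj, mul_left_comm, ← zpow_add₀ (hz0 t)]
    congr 2
    ring
  have hderiv : ∀ t : UnitAddCircle, (AddCircle.toCircle t : ℂ) ^ (a lo) *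
      ((AddCircle.toCircle t : ℂ) * p.derivative.eval (AddCircle.toCircle t : ℂ)) =
      ∑ j ∈ S, ((a j - a lo : ℤ) : ℂ) * c j * fourier (a j) t := by
    intro t
    rw [hp, Polynomial.derivative_sum, Polynomial.eval_finsetSum, Finset.mul_sum, Finset.mul_sum]
    refine Finset.sum_congr rfl fun j hj => ?_
    rw [fourier_eq_zpow, ← hez j hj, Polynomial.derivative_C_mul_X_pow, Polynomial.eval_mul,
      Polynomial.eval_C, Polynomial.eval_pow, Polynomial.eval_X]
    have h1 : (AddCircle.toCircle t : ℂ) ^ a j =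
        (AddCircle.toCircle t : ℂ) ^ a lo * (AddCircle.toCircle t : ℂ) ^ (e j) := by
      rw [← zpow_natCast, hez j hj, ← zpow_add₀ (hz0 t)]; congr 1; ring
    rw [h1]
    rcases Nat.eq_zero_or_pos (e j) with h0 | h0
    · simp [h0]
    · obtain ⟨r, hr⟩ : ∃ r, e j = r + 1 := ⟨e j - 1, by omega⟩
      rw [hr]
      simp only [add_tsub_cancel_right, pow_succ]
      push_cast
      ring
  have hl' : 0 < l - (D : ℝ) / 2 := by rw [hDr]; linarith
  have hmain := volume_le_norm_derivative hp0 hl'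
  rw [hdeg] at hmain
  rw [← hDr]
  refine (measure_mono fun t ht => ?_).trans hmain
  change l * _ ≤ _ at ht
  change (l - (D : ℝ) / 2) * _ ≤ _
  set z := (AddCircle.toCircle t : ℂ) with hz
  have hzn : ‖z ^ a lo‖ = 1 := by rw [norm_zpow, hz, Circle.norm_coe, one_zpow]
  have hx : ∃ s : ℝ, |s| = (D : ℝ) / 2 ∧ ∑ j ∈ S, ((a j - a i : ℤ) : ℂ) * c j * fourier (a j) t =
      z ^ a lo * (z * p.derivative.eval z - (D : ℂ) / 2 * p.eval z) + s * (z ^ a lo * p.eval z) := by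
    rcases hi' with rfl | rfl
    · refine ⟨(D : ℝ) / 2, abs_of_nonneg (by positivity), ?_⟩
      rw [← hderiv t]
      push_cast
      ring
    · refine ⟨-((D : ℝ) / 2), by rw [abs_neg]; exact abs_of_nonneg (by positivity), ?_⟩
      have h1 : ∑ j ∈ S, ((a j - a i : ℤ) : ℂ) * c j * fourier (a j) t =
          ∑ j ∈ S, ((a j - a lo : ℤ) : ℂ) * c j * fourier (a j) t -
            D * ∑ j ∈ S, c j * fourier (a j) t := by
        rw [Finset.mul_sum, ← Finset.sum_sub_distrib]
        refine Finset.sum_congr rfl fun j _ => ?_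
        have : (D : ℂ) = a i - a lo := by exact_mod_cast hDz
        rw [this]
        push_cast
        ring
      rw [h1, ← hderiv t, ← heval t]
      push_cast
      ring
  obtain ⟨s, hs, hx⟩ := hx
  rw [hx, ← heval t, norm_mul, hzn, one_mul] at ht
  have h2 := norm_add_le (z ^ a lo * (z * p.derivative.eval z - (D : ℂ) / 2 * p.eval z))
    (s * (z ^ a lo * p.eval z))
  simp only [norm_mul, hzn, one_mul, Complex.norm_real, Real.norm_eq_abs, hs] at h2 ht
  linarith

/-- **Lawton's bound for exponential sums.** An exponential sum with `k + 1` terms is smaller than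
`s` times the modulus of any one of its coefficients only on a set of measure at most
`5 k s ^ (1 / k)`. The induction divides by the extreme monomial farther from the distinguished
one and differentiates: either the derivative, which has `k` terms, is small, or the logarithmic
derivative is large. -/
theorem volume_norm_expSum_lt {ι : Type*} (k : ℕ) (S : Finset ι) (a : ι → ℤ) (c : ι → ℂ)
    (ha : Set.InjOn a S) (hc : ∀ i ∈ S, c i ≠ 0) (hS : S.card = k + 1) {j : ι} (hj : j ∈ S) {s : ℝ}
    (hs0 : 0 < s) (hs1 : s ≤ 1) :
    volume {t : UnitAddCircle | ‖∑ i ∈ S, c i * fourier (a i) t‖ < s * ‖c j‖} ≤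
      ENNReal.ofReal (5 * k * s ^ (1 / (k : ℝ))) := by
  classical
  induction k generalizing S c s with
  | zero =>
    obtain ⟨i, rfl⟩ := Finset.card_eq_one.1 hS
    obtain rfl := Finset.mem_singleton.1 hj
    refine le_of_eq_of_le ?_ zero_le
    convert measure_empty (μ := (volume : Measure UnitAddCircle))
    ext t
    simp only [Finset.sum_singleton, norm_mul, Set.mem_ofPred_eq, Set.mem_empty_iff_false, iff_false,
      not_lt]
    rw [fourier_apply, Circle.norm_coe, mul_one]
    exact mul_le_of_le_one_left (norm_nonneg _) hs1
  | succ k ih =>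
    have hSne : S.Nonempty := ⟨j, hj⟩
    obtain ⟨lo, hlo, hmin⟩ := Finset.exists_min_image S a hSne
    obtain ⟨hi, hhi, hmax⟩ := Finset.exists_max_image S a hSne
    set D : ℝ := (a hi : ℝ) - a lo with hD
    have hD0 : 0 < D := by
      obtain ⟨u, hu, v, hv, huv⟩ := Finset.one_lt_card.1 (by omega : 1 < S.card)
      have h1 : a lo ≠ a hi := by
        intro h
        apply huv
        apply ha hu hv
        linarith [hmin u hu, hmax u hu, hmin v hv, hmax v hv]
      have h2 : a lo < a hi := lt_of_le_of_ne (hmin _ hhi) h1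
      have h3 : (a lo : ℝ) < a hi := by exact_mod_cast h2
      linarith
    obtain ⟨i, hi', hij⟩ : ∃ i, (i = lo ∨ i = hi) ∧ D / 2 ≤ |(a j : ℝ) - a i| := by
      by_cases h : D / 2 ≤ |(a j : ℝ) - a lo|
      · exact ⟨lo, Or.inl rfl, h⟩
      · refine ⟨hi, Or.inr rfl, ?_⟩
        have h1 := le_abs_self ((a j : ℝ) - a lo)
        have h2 := neg_abs_le ((a j : ℝ) - a hi)
        linarith
    have hiS : i ∈ S := by rcases hi' with rfl | rfl <;> assumption
    have hji : j ≠ i := by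
      rintro rfl
      rw [sub_self, abs_zero] at hij
      linarith
    have hcj : 0 < ‖c j‖ := norm_pos_iff.2 (hc j hj)
    set κ : ℝ := (k : ℝ) + 1 with hκ
    have hκ0 : 0 < κ := by positivity
    push_cast
    set δ : ℝ := s ^ ((k : ℝ) / κ) with hδ
    have hδ0 : 0 < δ := Real.rpow_pos_of_pos hs0 _
    have hδ1 : δ ≤ 1 := Real.rpow_le_one hs0.le hs1 (by positivity)
    set y : ℝ := s ^ (1 / κ) with hy
    have hy0 : 0 < y := Real.rpow_pos_of_pos hs0 _
    have hδy : δ * y = s := by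
      rw [hδ, hy, ← Real.rpow_add hs0, ← add_div, ← hκ, div_self hκ0.ne', Real.rpow_one]
    rcases le_or_gt (1 / 5) y with hy5 | hy5
    · refine prob_le_one.trans ?_
      rw [ENNReal.one_le_ofReal]
      have : (0 : ℝ) ≤ k := k.cast_nonneg
      nlinarith
    set q : UnitAddCircle → ℂ := fun t =>
      ∑ r ∈ S, ((a r - a i : ℤ) : ℂ) * c r * fourier (a r) t with hq
    have hq' : ∀ t, ∑ r ∈ S.erase i, (((a r - a i : ℤ) : ℂ) * c r) * fourier (a r) t = q t := by
      intro t
      simp only [hq]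
      rw [← Finset.add_sum_erase S _ hiS]
      simp
    have hx : 1 < 1 / y := by rw [lt_div_iff₀ hy0]; linarith
    have hl : D / 2 < 1 / y * D / 2 := by nlinarith
    have hcov : {t : UnitAddCircle | ‖∑ r ∈ S, c r * fourier (a r) t‖ < s * ‖c j‖} ⊆
        {t | ‖∑ r ∈ S.erase i, (((a r - a i : ℤ) : ℂ) * c r) * fourier (a r) t‖ <
          δ * ‖((a j - a i : ℤ) : ℂ) * c j‖} ∪
        {t | 1 / y * D / 2 * ‖∑ r ∈ S, c r * fourier (a r) t‖ ≤ ‖q t‖} := by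
      intro t ht
      rw [Set.mem_ofPred_eq] at ht
      by_contra hcon
      rw [Set.mem_union, Set.mem_ofPred_eq, Set.mem_ofPred_eq, not_or, not_lt, not_le] at hcon
      obtain ⟨h1, h2⟩ := hcon
      rw [hq', norm_mul, Complex.norm_intCast] at h1
      push_cast at h1
      have h3 : 1 / y * D / 2 * ‖∑ r ∈ S, c r * fourier (a r) t‖ ≤ 1 / y * D / 2 * (s * ‖c j‖) :=
        mul_le_mul_of_nonneg_left ht.le (by positivity)
      have h4 : 1 / y * D / 2 * (s * ‖c j‖) = δ * (D / 2 * ‖c j‖) := by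
        rw [← hδy]; field_simp
      have h5 : δ * (D / 2 * ‖c j‖) ≤ δ * (|(a j : ℝ) - a i| * ‖c j‖) := by gcongr
      linarith
    refine (measure_mono hcov).trans ((measure_union_le _ _).trans ?_)
    have b1 := ih (S.erase i) (fun r => ((a r - a i : ℤ) : ℂ) * c r)
      (ha.mono (Finset.coe_subset.2 (Finset.erase_subset _ _)))
      (by
        intro r hr
        obtain ⟨hri, hrS⟩ := Finset.mem_erase.1 hr
        refine mul_ne_zero ?_ (hc r hrS)
        exact_mod_cast sub_ne_zero.2 fun h => hri (ha hrS hiS h))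
      (by rw [Finset.card_erase_of_mem hiS, hS]; rfl)
      (Finset.mem_erase.2 ⟨hji, hj⟩) hδ0 hδ1
    have b2 := volume_le_norm_expSum_derivative S a c ha hc hlo hhi hmin hmax hi' hl
    refine (add_le_add b1 b2).trans ?_
    have hkδ : (k : ℝ) * δ ^ (1 / (k : ℝ)) = k * y := by
      rcases Nat.eq_zero_or_pos k with rfl | hk
      · simp
      · have : (k : ℝ) ≠ 0 := by positivity
        rw [hδ, hy, ← Real.rpow_mul hs0.le]
        congr 2
        field_simp
    have hb : 2 * D / (1 / y * D / 2 - D / 2) ≤ 5 * y := by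
      have h1 : 1 / y * D / 2 - D / 2 = D * (1 - y) / (2 * y) := by field_simp
      have h2 : 2 * D / (D * (1 - y) / (2 * y)) = 4 * y / (1 - y) := by field_simp; ring
      rw [h1, h2, div_le_iff₀ (by linarith)]
      nlinarith
    rw [← ENNReal.ofReal_add (by positivity)
      (div_nonneg (by positivity) (by linarith))]
    refine ENNReal.ofReal_le_ofReal ?_
    have : 5 * (k : ℝ) * δ ^ (1 / (k : ℝ)) = 5 * (k * y) := by rw [mul_assoc, hkδ]
    rw [this]
    nlinarith

/-! ### Small values of Laurent polynomials on the torus -/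

namespace MahlerSubst

theorem monomialValue_torusPoint {n : ℕ} (x : UnitAddTorus (Fin n)) (v : Fin n → ℤ) :
    monomialValue (torusPoint x) v = ∏ j, fourier (v j) (x j) := by
  simp only [monomialValue, torusPoint, fourier_eq_zpow]

theorem torusPoint_ne_zero {n : ℕ} (x : UnitAddTorus (Fin n)) (j : Fin n) : torusPoint x j ≠ 0 :=
  Circle.coe_ne_zero _

theorem norm_monomialValue_torusPoint {n : ℕ} (x : UnitAddTorus (Fin n)) (v : Fin n → ℤ) :
    ‖monomialValue (torusPoint x) v‖ = 1 := by
  rw [monomialValue_torusPoint, norm_prod]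
  refine Finset.prod_eq_one fun j _ => ?_
  rw [fourier_apply, Circle.norm_coe]

theorem continuous_monomialValue_torusPoint {n : ℕ} (v : Fin n → ℤ) :
    Continuous fun x : UnitAddTorus (Fin n) => monomialValue (torusPoint x) v := by
  simp_rw [monomialValue_torusPoint]
  exact continuous_finsetProd _ fun j _ => (fourier (v j)).continuous.comp (continuous_apply j)

theorem eval_eq_sum {n : ℕ} (P : Laurent n) (z : Fin n → ℂ) :
    eval P z = ∑ v ∈ P.coeff.support, P.coeff v * monomialValue z v := rfl

theorem continuous_eval_torusPoint {n : ℕ} (P : Laurent n) :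
    Continuous fun x : UnitAddTorus (Fin n) => eval P (torusPoint x) := by
  simp_rw [eval_eq_sum]
  exact continuous_finsetSum _ fun v _ =>
    continuous_const.mul (continuous_monomialValue_torusPoint v)

/-- The monomials restricted to the line through `x` in the integral direction `u`. -/
theorem monomialValue_torusPoint_add {n : ℕ} (x : UnitAddTorus (Fin n)) (u v : Fin n → ℤ)
    (t : UnitAddCircle) :
    monomialValue (torusPoint (x + fun j => u j • t)) v =
      monomialValue (torusPoint x) v * fourier (∑ j, u j * v j) t := by
  have h : ∀ s : Finset (Fin n),
      ∏ j ∈ s, fourier (u j * v j) t = fourier (∑ j ∈ s, u j * v j) t := by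
    intro s
    induction s using Finset.induction_on with
    | empty => simp
    | insert a s ha ih => rw [Finset.prod_insert ha, Finset.sum_insert ha, fourier_add, ih]
  rw [monomialValue_torusPoint, monomialValue_torusPoint, ← h, ← Finset.prod_mul_distrib]
  refine Finset.prod_congr rfl fun j _ => ?_
  simp only [Pi.add_apply, fourier_eq_zpow, AddCircle.toCircle_add, AddCircle.toCircle_zsmul,
    Circle.coe_mul, Circle.coe_zpow, mul_zpow, zpow_mul]

/-- Some integral linear form is injective on a given finite set of integral vectors: evaluate
the nonzero polynomials `∑ (v - w)_j X ^ j` off their roots. -/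
theorem exists_injOn_linearForm {n : ℕ} (S : Finset (Fin n → ℤ)) :
    ∃ u : Fin n → ℤ, Set.InjOn (fun v : Fin n → ℤ => ∑ j, u j * v j) S := by
  classical
  let p : (Fin n → ℤ) → Polynomial ℤ := fun d => ∑ j, Polynomial.C (d j) * Polynomial.X ^ (j : ℕ)
  have hp : ∀ d, d ≠ 0 → p d ≠ 0 := by
    intro d hd h
    apply hd
    funext i
    have h1 : (p d).coeff i = d i := by
      simp only [p, Polynomial.finsetSum_coeff, Polynomial.coeff_C_mul_X_pow]
      rw [Finset.sum_eq_single i (fun j _ hj => if_neg fun h => hj (Fin.ext h.symm)) (by simp)]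
      simp
    rw [← h1, h, Polynomial.coeff_zero, Pi.zero_apply]
  have hprod : (∏ w ∈ S.offDiag, p (w.1 - w.2)) ≠ 0 :=
    Finset.prod_ne_zero_iff.2 fun w hw => hp _ (sub_ne_zero.2 (Finset.mem_offDiag.1 hw).2.2)
  obtain ⟨z, hz⟩ : ∃ z, (∏ w ∈ S.offDiag, p (w.1 - w.2)).eval z ≠ 0 := by
    by_contra! h
    exact hprod (Polynomial.funext fun r => by simpa using h r)
  refine ⟨fun j => z ^ (j : ℕ), fun v hv w hw hvw => ?_⟩
  by_contra hne
  rw [Polynomial.eval_prod] at hz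
  apply Finset.prod_ne_zero_iff.1 hz (v, w) (Finset.mem_offDiag.2 ⟨hv, hw, hne⟩)
  have hvw' : ∑ j : Fin n, z ^ (j : ℕ) * v j = ∑ j : Fin n, z ^ (j : ℕ) * w j := hvw
  simp only [p, Polynomial.eval_finsetSum, Polynomial.eval_mul, Polynomial.eval_C,
    Polynomial.eval_pow, Polynomial.eval_X, Pi.sub_apply, sub_mul, Finset.sum_sub_distrib]
  simp only [mul_comm (v _), mul_comm (w _), hvw', sub_self]

instance (n : ℕ) : IsProbabilityMeasure (volume : Measure (UnitAddTorus (Fin n))) :=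
  inferInstanceAs (IsProbabilityMeasure (Measure.pi fun _ : Fin n => (volume : Measure UnitAddCircle)))

/-- A set that meets every line of integral direction `u` in measure at most `C` has measure at
most `C`, by translation invariance and Tonelli's theorem. -/
theorem volume_le_of_slices {n : ℕ} {B : Set (UnitAddTorus (Fin n))} (hB : MeasurableSet B)
    (u : Fin n → ℤ) {C : ENNReal}
    (h : ∀ x : UnitAddTorus (Fin n), volume {t : UnitAddCircle | x + (fun j => u j • t) ∈ B} ≤ C) :
    volume B ≤ C := by
  have hcont : Continuous fun q : UnitAddTorus (Fin n) × UnitAddCircle =>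
      q.1 + (fun j => u j • q.2) := by fun_prop
  have hmeas : Measurable fun q : UnitAddTorus (Fin n) × UnitAddCircle =>
      B.indicator (fun _ => (1 : ENNReal)) (q.1 + (fun j => u j • q.2)) :=
    (measurable_const.indicator hB).comp hcont.measurable
  calc volume B = ∫⁻ _ : UnitAddCircle, volume B := by simp
    _ = ∫⁻ t : UnitAddCircle, ∫⁻ x : UnitAddTorus (Fin n),
          B.indicator (fun _ => (1 : ENNReal)) (x + (fun j => u j • t)) := by
        refine lintegral_congr fun t => ?_
        rw [lintegral_add_right_eq_self (fun x => B.indicator (fun _ => (1 : ENNReal)) x),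
          lintegral_indicator_const hB, one_mul]
    _ = ∫⁻ x : UnitAddTorus (Fin n), ∫⁻ t : UnitAddCircle,
          B.indicator (fun _ => (1 : ENNReal)) (x + (fun j => u j • t)) :=
        (lintegral_lintegral_swap hmeas.aemeasurable).symm
    _ ≤ ∫⁻ _ : UnitAddTorus (Fin n), C := by
        refine lintegral_mono fun x => ?_
        refine le_of_eq_of_le ?_ (h x)
        have hm : MeasurableSet {t : UnitAddCircle | x + (fun j => u j • t) ∈ B} :=
          (hcont.comp (Continuous.prodMk_right x)).measurable hB
        rw [← one_mul (volume _), ← lintegral_indicator_const hm]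
        rfl
    _ = C := by simp

/-- A Laurent polynomial with `k + 1` nonzero coefficients is smaller than `s` times the modulus
of one of its coefficients only on a set of measure at most `5 k s ^ (1 / k)`. The bound does not
depend on the number of variables: on every line in a generic integral direction the
polynomial is an exponential sum with coefficients of the same moduli. -/
theorem volume_norm_eval_lt {n k : ℕ} (P : Laurent n) (hP : numCoeffs P = k + 1)
    {v₀ : Fin n → ℤ} (hv₀ : v₀ ∈ P.coeff.support) {s : ℝ} (hs0 : 0 < s) (hs1 : s ≤ 1) :
    volume {x : UnitAddTorus (Fin n) | ‖eval P (torusPoint x)‖ < s * ‖P.coeff v₀‖} ≤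
      ENNReal.ofReal (5 * k * s ^ (1 / (k : ℝ))) := by
  obtain ⟨u, hu⟩ := exists_injOn_linearForm P.coeff.support
  refine volume_le_of_slices ?_ u fun x => ?_
  · exact (isOpen_lt (continuous_eval_torusPoint P).norm continuous_const).measurableSet
  · have h1 := volume_norm_expSum_lt k P.coeff.support (fun v => ∑ j, u j * v j)
      (fun v => P.coeff v * monomialValue (torusPoint x) v) hu ?_ hP hv₀ hs0 hs1
    · rw [norm_mul, norm_monomialValue_torusPoint, mul_one] at h1
      refine le_of_eq_of_le ?_ h1
      congr 1
      ext t
      simp only [Set.mem_ofPred_eq, eval_eq_sum, monomialValue_torusPoint_add, mul_assoc]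
    · intro v hv
      refine mul_ne_zero (Finsupp.mem_support_iff.1 hv) ?_
      rw [← norm_pos_iff, norm_monomialValue_torusPoint]
      exact one_pos

end MahlerSubst

/-! ### Integrating the logarithm of a function with few small values -/

theorem Real.Gamma_le_two {a : ℝ} (h1 : 1 / 2 ≤ a) (h2 : a ≤ 1) : Real.Gamma a ≤ 2 := by
  have h3 : Real.Gamma (a + 1) ≤ 1 := by
    obtain ⟨-, hconv⟩ := Real.convexOn_Gamma
    have := hconv (show (1 : ℝ) ∈ Set.Ioi 0 by simp) (show (2 : ℝ) ∈ Set.Ioi 0 by simp)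
      (show (0 : ℝ) ≤ 1 - a by linarith) (show (0 : ℝ) ≤ a by linarith) (by ring)
    simp only [smul_eq_mul, Real.Gamma_one, Real.Gamma_two] at this
    have e : (1 - a) * 1 + a * 2 = a + 1 := by ring
    rw [e] at this
    linarith
  rw [Real.Gamma_add_one (by linarith)] at h3
  have h4 : 0 < Real.Gamma a := Real.Gamma_pos_of_pos (by linarith)
  nlinarith

/-- If `h` has values below `s` only on a set of measure at most `C s ^ α`, the error made in
replacing `log h` by `log (h ^ 2 + ε ^ 2) / 2` has integral at most `C ε ^ α (4 / α)`. This is the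
layer-cake formula; the set where the error exceeds `t` is contained in
`h < ε t ^ (-1/2) e ^ (-t/2)`, which leads to a Gamma integral. -/
theorem lintegral_log_one_add_le {X : Type*} [MeasurableSpace X] {μ : Measure X}
    {h : X → ℝ} (hm : Measurable h) (h0 : ∀ x, 0 ≤ h x) {C α ε : ℝ} (hC : 0 ≤ C) (hα0 : 0 < α)
    (hα1 : α ≤ 1) (hε : 0 < ε)
    (hμ : ∀ s, 0 < s → μ {x | h x < s} ≤ ENNReal.ofReal (C * s ^ α)) :
    ∫⁻ x, ENNReal.ofReal (1 / 2 * Real.log (1 + ε ^ 2 / h x ^ 2)) ∂μ ≤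
      ENNReal.ofReal (C * ε ^ α * (4 / α)) := by
  have hφ0 : ∀ x, 0 ≤ 1 / 2 * Real.log (1 + ε ^ 2 / h x ^ 2) := fun x => by
    have : 0 ≤ Real.log (1 + ε ^ 2 / h x ^ 2) := Real.log_nonneg (by
      have : 0 ≤ ε ^ 2 / h x ^ 2 := by positivity
      linarith)
    positivity
  have hφm : Measurable fun x => 1 / 2 * Real.log (1 + ε ^ 2 / h x ^ 2) := by fun_prop
  rw [lintegral_eq_lintegral_meas_lt μ (Eventually.of_forall hφ0) hφm.aemeasurable]
  have hb : ∀ t ∈ Set.Ioi (0 : ℝ), μ {a | t < 1 / 2 * Real.log (1 + ε ^ 2 / h a ^ 2)} ≤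
      ENNReal.ofReal (C * ε ^ α * (t ^ ((1 - α / 2) - 1) * Real.exp (-(α / 2 * t)))) := by
    intro t ht
    have ht0 : (0 : ℝ) < t := ht
    have hs : 0 < ε * (t ^ (-(1 / 2) : ℝ) * Real.exp (-(t / 2))) := by positivity
    have hsq : (ε * (t ^ (-(1 / 2) : ℝ) * Real.exp (-(t / 2)))) ^ 2 = ε ^ 2 * (t⁻¹ * Real.exp (-t)) := by
      have e1 : (t ^ (-(1 / 2) : ℝ)) ^ 2 = t⁻¹ := by
        rw [← Real.rpow_mul_natCast ht0.le, ← Real.rpow_neg_one]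
        norm_num
      have e2 : Real.exp (-(t / 2)) ^ 2 = Real.exp (-t) := by
        rw [← Real.exp_nat_mul]
        congr 1
        push_cast
        ring
      rw [mul_pow, mul_pow, e1, e2]
    refine (measure_mono (t := {a | h a < ε * (t ^ (-(1 / 2) : ℝ) * Real.exp (-(t / 2)))})
      fun a ha => ?_).trans ((hμ _ hs).trans (ENNReal.ofReal_le_ofReal (le_of_eq ?_)))
    · rw [Set.mem_ofPred_eq] at ha ⊢
      rcases (h0 a).eq_or_lt with ha0 | ha0
      · rw [← ha0]; exact hs
      refine lt_of_pow_lt_pow_left₀ 2 hs.le ?_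
      rw [hsq]
      have h1 : Real.exp (2 * t) < 1 + ε ^ 2 / h a ^ 2 := by
        rw [← Real.lt_log_iff_exp_lt (by positivity)]
        linarith
      have h2 : t * Real.exp t ≤ Real.exp (2 * t) - 1 := by
        have h3 := Real.self_le_sinh_iff.2 ht0.le
        rw [Real.sinh_eq] at h3
        have h4 : Real.exp (2 * t) = Real.exp t * Real.exp t := by rw [← Real.exp_add]; ring_nf
        have h5 : Real.exp t * Real.exp (-t) = 1 := by rw [← Real.exp_add]; simp
        have := Real.exp_pos t
        nlinarith
      have h6 : t * Real.exp t < ε ^ 2 / h a ^ 2 := by linarith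
      rw [lt_div_iff₀ (by positivity)] at h6
      rw [Real.exp_neg, ← mul_inv, ← div_eq_mul_inv, lt_div_iff₀ (by positivity)]
      linarith
    · rw [Real.mul_rpow hε.le (by positivity), Real.mul_rpow (by positivity) (by positivity),
        ← Real.rpow_mul ht0.le, ← Real.exp_mul]
      ring_nf
  refine (setLIntegral_mono' measurableSet_Ioi hb).trans ?_
  have hint : IntegrableOn (fun t : ℝ => t ^ ((1 - α / 2) - 1) * Real.exp (-(α / 2 * t)))
      (Set.Ioi 0) := by
    have := integrableOn_rpow_mul_exp_neg_mul_rpow (p := 1) (s := (1 - α / 2) - 1) (b := α / 2)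
      (by linarith) one_pos (by linarith)
    simpa using this
  rw [← ofReal_integral_eq_lintegral_ofReal (hint.const_mul _)]
  · refine ENNReal.ofReal_le_ofReal ?_
    rw [integral_const_mul, Real.integral_rpow_mul_exp_neg_mul_Ioi (by linarith) (by linarith)]
    refine mul_le_mul_of_nonneg_left ?_ (by positivity)
    have h1 := Real.Gamma_le_two (a := 1 - α / 2) (by linarith) (by linarith)
    have h2 : (1 / (α / 2)) ^ (1 - α / 2) ≤ (1 / (α / 2)) ^ (1 : ℝ) := by
      refine Real.rpow_le_rpow_of_exponent_le ?_ (by linarith)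
      rw [le_div_iff₀ (by positivity)]
      linarith
    rw [Real.rpow_one] at h2
    calc _ ≤ 1 / (α / 2) * 2 := by
          refine mul_le_mul h2 h1 (Real.Gamma_pos_of_pos (by linarith)).le (by positivity)
      _ = 4 / α := by field_simp; norm_num
  · filter_upwards [ae_restrict_mem measurableSet_Ioi] with t ht
    have : (0 : ℝ) < t := ht
    positivity

theorem integrable_log_and_abs_sub_le {X : Type*} [MeasurableSpace X] {μ : Measure X}
    [IsProbabilityMeasure μ] {h : X → ℝ} (hm : Measurable h) (h0 : ∀ x, 0 ≤ h x) {M : ℝ}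
    (hM : ∀ x, h x ≤ M) {C α ε : ℝ} (hC : 0 ≤ C) (hα0 : 0 < α) (hα1 : α ≤ 1) (hε : 0 < ε)
    (hμ : ∀ s, 0 < s → μ {x | h x < s} ≤ ENNReal.ofReal (C * s ^ α)) :
    Integrable (fun x => Real.log (h x)) μ ∧
      |∫ x, Real.log (h x) ∂μ - ∫ x, 1 / 2 * Real.log (h x ^ 2 + ε ^ 2) ∂μ| ≤
        C * ε ^ α * (4 / α) := by
  have hnz : ∀ᵐ x ∂μ, h x ≠ 0 := by
    rw [ae_iff]
    have hlim : Tendsto (fun s : ℝ => ENNReal.ofReal (C * s ^ α)) (𝓝[>] 0) (𝓝 0) := by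
      have h1 : Tendsto (fun s : ℝ => s ^ α) (𝓝[>] 0) (𝓝 0) := by
        have := (Real.continuousAt_rpow_const 0 α (Or.inr hα0.le)).tendsto
        rw [Real.zero_rpow hα0.ne'] at this
        exact this.mono_left nhdsWithin_le_nhds
      simpa using ENNReal.tendsto_ofReal (h1.const_mul C)
    refine le_antisymm (ge_of_tendsto hlim ?_) zero_le
    filter_upwards [self_mem_nhdsWithin] with s hs
    refine (measure_mono fun x hx => ?_).trans (hμ s hs)
    rw [Set.mem_ofPred_eq, not_not] at hx
    rw [Set.mem_ofPred_eq, hx]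
    exact hs
  have hφ0 : ∀ x, 0 ≤ 1 / 2 * Real.log (1 + ε ^ 2 / h x ^ 2) := fun x => by
    have : 0 ≤ Real.log (1 + ε ^ 2 / h x ^ 2) := Real.log_nonneg (by
      have : 0 ≤ ε ^ 2 / h x ^ 2 := by positivity
      linarith)
    positivity
  have hφm : Measurable fun x => 1 / 2 * Real.log (1 + ε ^ 2 / h x ^ 2) := by fun_prop
  have hlin := lintegral_log_one_add_le hm h0 hC hα0 hα1 hε hμ
  have hφi : Integrable (fun x => 1 / 2 * Real.log (1 + ε ^ 2 / h x ^ 2)) μ := by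
    refine ⟨hφm.aestronglyMeasurable, ?_⟩
    rw [hasFiniteIntegral_iff_ofReal (Eventually.of_forall hφ0)]
    exact hlin.trans_lt ENNReal.ofReal_lt_top
  have hgi : Integrable (fun x => 1 / 2 * Real.log (h x ^ 2 + ε ^ 2)) μ := by
    have hgm : Measurable fun x => 1 / 2 * Real.log (h x ^ 2 + ε ^ 2) := by fun_prop
    refine Integrable.of_bound hgm.aestronglyMeasurable
      (1 / 2 * max |Real.log (ε ^ 2)| |Real.log (M ^ 2 + ε ^ 2)|) (Eventually.of_forall fun x => ?_)
    rw [norm_mul, Real.norm_of_nonneg (by norm_num : (0 : ℝ) ≤ 1 / 2), Real.norm_eq_abs]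
    refine mul_le_mul_of_nonneg_left (abs_le_max_abs_abs ?_ ?_) (by norm_num)
    · exact Real.log_le_log (by positivity) (by nlinarith [h0 x])
    · exact Real.log_le_log (by positivity) (by
        have := pow_le_pow_left₀ (h0 x) (hM x) 2
        linarith)
  have heq : (fun x => Real.log (h x)) =ᵐ[μ]
      fun x => 1 / 2 * Real.log (h x ^ 2 + ε ^ 2) - 1 / 2 * Real.log (1 + ε ^ 2 / h x ^ 2) := by
    filter_upwards [hnz] with x hx
    have hx0 : 0 < h x := lt_of_le_of_ne (h0 x) (Ne.symm hx)
    have h1 : h x ^ 2 + ε ^ 2 = h x ^ 2 * (1 + ε ^ 2 / h x ^ 2) := by field_simp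
    have h2 : Real.log (h x ^ 2) = 2 * Real.log (h x) := by rw [Real.log_pow]; norm_num
    rw [h1, Real.log_mul (by positivity) (by positivity), h2]
    ring
  refine ⟨(hgi.sub hφi).congr heq.symm, ?_⟩
  rw [integral_congr_ae heq, integral_sub hgi hφi, sub_sub_cancel_left, abs_neg,
    abs_of_nonneg (integral_nonneg hφ0),
    integral_eq_lintegral_of_nonneg_ae (Eventually.of_forall hφ0) hφm.aestronglyMeasurable]
  exact ENNReal.toReal_le_of_le_ofReal (by positivity) hlin

/-! ### Polynomial approximation of the logarithm -/

/-- The truncated Chebyshev expansion `log |1 - r e^{iθ}| = - ∑ r ^ n cos (n θ) / n` approximates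
`log (u + ε ^ 2) / 2`, for `ε = M (1 - r) / (2 √r)`, uniformly on `[0, M ^ 2]`. -/
theorem exists_polynomial_approx_log {r M : ℝ} (hr0 : 0 < r) (hr1 : r < 1) (hM : 0 < M) (N : ℕ) :
    ∃ Q : Polynomial ℝ, Q.natDegree ≤ N ∧ ∀ u, 0 ≤ u → u ≤ M ^ 2 →
      |1 / 2 * Real.log (u + (M * (1 - r) / (2 * √r)) ^ 2) - Q.eval u| ≤ r ^ (N + 1) / (1 - r) := by
  set A : Polynomial ℝ := Polynomial.C 1 - Polynomial.C (2 / M ^ 2) * Polynomial.X with hA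
  have hAdeg : A.natDegree ≤ 1 := by
    refine (Polynomial.natDegree_sub_le _ _).trans (max_le (by simp) ?_)
    exact (Polynomial.natDegree_C_mul_le _ _).trans Polynomial.natDegree_X_le
  set Q : Polynomial ℝ := Polynomial.C (1 / 2 * Real.log (M ^ 2 / (4 * r))) -
    ∑ n ∈ Finset.range (N + 1), Polynomial.C (r ^ n / n) * (Polynomial.Chebyshev.T ℝ n).comp A with hQ
  refine ⟨Q, ?_, fun u hu0 hu1 => ?_⟩
  · refine (Polynomial.natDegree_sub_le _ _).trans
      (max_le (by rw [Polynomial.natDegree_C]; exact Nat.zero_le _) ?_)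
    refine Polynomial.natDegree_sum_le_of_forall_le _ _ fun n hn => ?_
    refine (Polynomial.natDegree_C_mul_le _ _).trans ?_
    rw [Polynomial.natDegree_comp, Polynomial.Chebyshev.natDegree_T, Int.natAbs_natCast]
    have h1 : n ≤ N := Nat.lt_succ_iff.1 (Finset.mem_range.1 hn)
    nlinarith
  · set x : ℝ := 1 - 2 / M ^ 2 * u with hx
    have hx1 : x ≤ 1 := by
      have : 0 ≤ 2 / M ^ 2 * u := by positivity
      linarith
    have hx2 : -1 ≤ x := by
      have : 2 / M ^ 2 * u ≤ 2 := by
        rw [div_mul_eq_mul_div, div_le_iff₀ (by positivity)]; linarith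
      linarith
    set θ := Real.arccos x with hθ
    have hcos : Real.cos θ = x := Real.cos_arccos hx2 hx1
    set z : ℂ := r * Complex.exp (θ * Complex.I) with hz
    have hzn : ‖z‖ = r := by
      rw [hz, norm_mul, Complex.norm_exp_ofReal_mul_I, mul_one, Complex.norm_real,
        Real.norm_of_nonneg hr0.le]
    have hzpow : ∀ n : ℕ, (z ^ n / n).re = r ^ n / n * Real.cos (n * θ) := by
      intro n
      have h1 : z ^ n = (r ^ n : ℝ) * Complex.exp (((n * θ : ℝ) : ℂ) * Complex.I) := by
        rw [hz, mul_pow, ← Complex.exp_nat_mul]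
        push_cast
        ring_nf
      rw [h1, mul_div_assoc, Complex.re_ofReal_mul, Complex.div_natCast_re, Complex.exp_ofReal_mul_I_re]
      ring
    have hsum : HasSum (fun n : ℕ => r ^ n / n * Real.cos (n * θ)) (-Real.log ‖1 - z‖) := by
      have := Complex.hasSum_re (Complex.hasSum_taylorSeries_neg_log (z := z) (by rw [hzn]; exact hr1))
      simpa only [hzpow, Complex.neg_re, Complex.log_re] using this
    have hbound : ∀ n : ℕ, ‖r ^ n / n * Real.cos (n * θ)‖ ≤ 1 * r ^ n := by
      intro n
      rw [norm_mul, norm_div, norm_pow, Real.norm_of_nonneg hr0.le, one_mul]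
      have h1 : r ^ n / ‖(n : ℝ)‖ ≤ r ^ n := by
        rcases Nat.eq_zero_or_pos n with rfl | hn
        · simp
        · refine div_le_self (by positivity) ?_
          rw [Real.norm_natCast]
          exact_mod_cast hn
      calc _ ≤ r ^ n * 1 := mul_le_mul h1 (Real.abs_cos_le_one _) (abs_nonneg _) (by positivity)
        _ = _ := mul_one _
    have htail := norm_sub_le_of_geometric_bound_of_hasSum hr1 hbound hsum (N + 1)
    rw [one_mul] at htail
    have hnorm : ‖1 - z‖ ^ 2 = 1 + r ^ 2 - 2 * r * x := by
      rw [Complex.sq_norm, Complex.normSq_apply]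
      have h1 : (1 - z).re = 1 - r * x := by
        rw [Complex.sub_re, hz, Complex.re_ofReal_mul, Complex.exp_ofReal_mul_I_re, hcos,
          Complex.one_re]
      have h2 : (1 - z).im = -(r * Real.sin θ) := by
        rw [Complex.sub_im, hz, Complex.im_ofReal_mul, Complex.exp_ofReal_mul_I_im, Complex.one_im,
          zero_sub]
      have h3 := Real.sin_sq_add_cos_sq θ
      rw [hcos] at h3
      rw [h1, h2]
      linear_combination r ^ 2 * h3
    have hpos : 0 < ‖1 - z‖ := by
      have h1 : ‖z‖ < 1 := by rw [hzn]; exact hr1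
      have := norm_sub_norm_le 1 z
      rw [norm_one] at this
      linarith
    have hlog : 1 / 2 * Real.log (u + (M * (1 - r) / (2 * √r)) ^ 2) =
        1 / 2 * Real.log (M ^ 2 / (4 * r)) + Real.log ‖1 - z‖ := by
      have h1 : u + (M * (1 - r) / (2 * √r)) ^ 2 = M ^ 2 / (4 * r) * ‖1 - z‖ ^ 2 := by
        rw [hnorm, div_pow, mul_pow 2, Real.sq_sqrt hr0.le, hx]
        field_simp
        ring
      rw [h1, Real.log_mul (by positivity) (by positivity), Real.log_pow]
      push_cast
      ring
    have heval : Q.eval u = 1 / 2 * Real.log (M ^ 2 / (4 * r)) -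
        ∑ n ∈ Finset.range (N + 1), r ^ n / n * Real.cos (n * θ) := by
      have h1 : A.eval u = Real.cos θ := by
        rw [hcos, hA]
        simp [hx]
      simp only [hQ, Polynomial.eval_sub, Polynomial.eval_C, Polynomial.eval_finsetSum,
        Polynomial.eval_mul, Polynomial.eval_comp, h1, Polynomial.Chebyshev.T_real_cos, Int.cast_natCast]
    rw [hlog, heval]
    refine le_of_eq_of_le ?_ htail
    rw [Real.norm_eq_abs]
    congr 1
    ring

/-! ### Moments and monomial substitutions -/

namespace MahlerSubst

theorem monomialValue_torusPoint_sum {n : ℕ} {ι : Type*} (s : Finset ι) (x : UnitAddTorus (Fin n))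
    (b : ι → Fin n → ℤ) :
    monomialValue (torusPoint x) (∑ i ∈ s, b i) = ∏ i ∈ s, monomialValue (torusPoint x) (b i) := by
  classical
  induction s using Finset.induction_on with
  | empty => simp [monomialValue]
  | insert i s hi ih =>
    rw [Finset.sum_insert hi, Finset.prod_insert hi, ← ih, monomialValue, monomialValue,
      monomialValue, ← Finset.prod_mul_distrib]
    exact Finset.prod_congr rfl fun j _ => zpow_add₀ (torusPoint_ne_zero x j) _ _

theorem monomialValue_torusPoint_sub {n : ℕ} (x : UnitAddTorus (Fin n)) (v w : Fin n → ℤ) :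
    monomialValue (torusPoint x) (v - w) = monomialValue (torusPoint x) v *
      (starRingEnd ℂ) (monomialValue (torusPoint x) w) := by
  rw [← Complex.inv_eq_conj (norm_monomialValue_torusPoint x w), monomialValue, monomialValue,
    monomialValue, ← Finset.prod_inv_distrib, ← Finset.prod_mul_distrib]
  refine Finset.prod_congr rfl fun j _ => ?_
  rw [Pi.sub_apply, zpow_sub₀ (torusPoint_ne_zero x j), div_eq_mul_inv]

/-- Orthogonality of the characters of the torus, from translation by a suitable point. -/
theorem integral_monomialValue_torusPoint {n : ℕ} (v : Fin n → ℤ) :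
    ∫ x : UnitAddTorus (Fin n), monomialValue (torusPoint x) v = if v = 0 then 1 else 0 := by
  classical
  split_ifs with hv
  · subst hv
    simp [monomialValue]
  · obtain ⟨i, hi⟩ : ∃ i, v i ≠ 0 := Function.ne_iff.1 hv
    have h1 : fourier (v i) (((1 : ℝ) / 2 / v i : ℝ) : UnitAddCircle) = -1 := by
      have := fourier_add_half_inv_index (T := 1) hi one_pos 0
      rwa [zero_add, fourier_eval_zero] at this
    have h2 := integral_add_right_eq_self (μ := (volume : Measure (UnitAddTorus (Fin n))))
      (fun x => monomialValue (torusPoint x) v)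
      (fun j => (Pi.single i 1 : Fin n → ℤ) j • (((1 : ℝ) / 2 / v i : ℝ) : UnitAddCircle))
    have h3 : ∑ j, (Pi.single i 1 : Fin n → ℤ) j * v j = v i := by
      rw [Finset.sum_eq_single i (fun j _ hj => by simp [hj]) (by simp)]
      simp
    simp only [monomialValue_torusPoint_add, h3, h1, mul_neg_one] at h2
    rw [integral_neg] at h2
    exact self_eq_neg.1 h2.symm

/-- The `2 j`-th moment of a trigonometric sum, expanded in its coefficients. -/
theorem integral_norm_sq_pow {n : ℕ} {ι : Type*} (S : Finset ι) (c : ι → ℂ) (b : ι → Fin n → ℤ)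
    (j : ℕ) :
    ((∫ x : UnitAddTorus (Fin n),
        (‖∑ i ∈ S, c i * monomialValue (torusPoint x) (b i)‖ ^ 2) ^ j : ℝ) : ℂ) =
      ∑ g ∈ Fintype.piFinset fun _ : Fin j => S ×ˢ S,
        (∏ l, c (g l).1 * (starRingEnd ℂ) (c (g l).2)) *
          if ∑ l, (b (g l).1 - b (g l).2) = 0 then 1 else 0 := by
  have hexp : ∀ x : UnitAddTorus (Fin n),
      (((‖∑ i ∈ S, c i * monomialValue (torusPoint x) (b i)‖ ^ 2) ^ j : ℝ) : ℂ) =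
      ∑ g ∈ Fintype.piFinset fun _ : Fin j => S ×ˢ S,
        (∏ l, c (g l).1 * (starRingEnd ℂ) (c (g l).2)) *
          monomialValue (torusPoint x) (∑ l, (b (g l).1 - b (g l).2)) := by
    intro x
    have h1 : (((‖∑ i ∈ S, c i * monomialValue (torusPoint x) (b i)‖ ^ 2 : ℝ)) : ℂ) =
        ∑ q ∈ S ×ˢ S, c q.1 * (starRingEnd ℂ) (c q.2) *
          monomialValue (torusPoint x) (b q.1 - b q.2) := by
      rw [Complex.ofReal_pow, ← Complex.mul_conj', map_sum, Finset.sum_mul_sum, Finset.sum_product]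
      refine Finset.sum_congr rfl fun i _ => Finset.sum_congr rfl fun i' _ => ?_
      rw [monomialValue_torusPoint_sub, map_mul]
      ring
    rw [Complex.ofReal_pow, h1, Finset.sum_pow']
    refine Finset.sum_congr rfl fun g _ => ?_
    rw [Finset.prod_mul_distrib, monomialValue_torusPoint_sum]
  rw [← integral_complex_ofReal]
  simp_rw [hexp]
  rw [integral_finsetSum]
  · simp_rw [integral_const_mul, integral_monomialValue_torusPoint]
  · intro g _
    refine Integrable.const_mul ?_ _
    exact Integrable.of_bound (continuous_monomialValue_torusPoint _).aestronglyMeasurable 1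
      (Eventually.of_forall fun x => (norm_monomialValue_torusPoint x _).le)

theorem eval_subst_torusPoint {m n : ℕ} (P : Laurent n) (A : Matrix (Fin m) (Fin n) ℤ)
    (x : UnitAddTorus (Fin m)) :
    eval (subst P A) (torusPoint x) =
      ∑ v ∈ P.coeff.support, P.coeff v * monomialValue (torusPoint x) (A.mulVec v) := by
  rw [eval_subst P A _ (torusPoint_ne_zero x), eval_eq_sum]
  simp_rw [monomialValue_powMatrix _ (torusPoint_ne_zero x)]

/-- If the support of `P` has width at most `d` in each coordinate, and the nonzero integral
vectors in the kernel of `A` have norm greater than `N d`, the substitution by `A` preserves the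
integrals of polynomials of degree at most `N` in `|P| ^ 2`. -/
theorem integral_polynomial_norm_sq_subst {m n : ℕ} (P : Laurent n) (A : Matrix (Fin m) (Fin n) ℤ)
    {N d : ℕ} (hd : ∀ v ∈ P.coeff.support, ∀ w ∈ P.coeff.support, ‖v - w‖ ≤ d)
    (hA : ∀ v, v ≠ 0 → A.mulVec v = 0 → (N * d : ℝ) < ‖v‖) {Q : Polynomial ℝ}
    (hQ : Q.natDegree ≤ N) :
    ∫ x : UnitAddTorus (Fin m), Q.eval (‖eval (subst P A) (torusPoint x)‖ ^ 2) =
      ∫ x : UnitAddTorus (Fin n), Q.eval (‖eval P (torusPoint x)‖ ^ 2) := by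
  have hmom : ∀ j ≤ N, ∫ x : UnitAddTorus (Fin m), (‖eval (subst P A) (torusPoint x)‖ ^ 2) ^ j =
      ∫ x : UnitAddTorus (Fin n), (‖eval P (torusPoint x)‖ ^ 2) ^ j := by
    intro j hj
    rw [← Complex.ofReal_inj]
    simp_rw [eval_subst_torusPoint, eval_eq_sum]
    rw [integral_norm_sq_pow, integral_norm_sq_pow]
    refine Finset.sum_congr rfl fun g hg => ?_
    congr 1
    have hlin : ∑ l, (A.mulVec (g l).1 - A.mulVec (g l).2) = A.mulVec (∑ l, ((g l).1 - (g l).2)) := by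
      simp_rw [← Matrix.mulVec_sub]
      exact (map_sum (Matrix.mulVecLin A) _ _).symm
    rw [hlin]
    refine if_congr ⟨fun h => ?_, fun h => by rw [h, Matrix.mulVec_zero]⟩ rfl rfl
    by_contra hne
    have h1 := hA _ hne h
    have h2 : ‖∑ l, ((g l).1 - (g l).2)‖ ≤ ∑ _l : Fin j, (d : ℝ) := by
      refine norm_sum_le_of_le _ fun l _ => ?_
      have := Finset.mem_product.1 (Fintype.mem_piFinset.1 hg l)
      exact hd _ this.1 _ this.2
    rw [Finset.sum_const, Finset.card_univ, Fintype.card_fin, nsmul_eq_mul] at h2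
    have h3 : (j : ℝ) ≤ N := by exact_mod_cast hj
    have h4 : (0 : ℝ) ≤ d := d.cast_nonneg
    nlinarith
  have hint : ∀ {l : ℕ} (R : Laurent l) (j : ℕ),
      Integrable fun x : UnitAddTorus (Fin l) => Q.coeff j * (‖eval R (torusPoint x)‖ ^ 2) ^ j := by
    intro l R j
    refine Continuous.integrable_of_hasCompactSupport ?_ (HasCompactSupport.of_compactSpace _)
    exact continuous_const.mul (((continuous_eval_torusPoint R).norm.pow 2).pow j)
  simp_rw [Polynomial.eval_eq_sum_range]
  rw [integral_finsetSum _ fun j _ => hint _ j, integral_finsetSum _ fun j _ => hint _ j]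
  refine Finset.sum_congr rfl fun j hj => ?_
  rw [integral_const_mul, integral_const_mul,
    hmom j ((Nat.lt_succ_iff.1 (Finset.mem_range.1 hj)).trans hQ)]

theorem norm_eval_torusPoint_le {n : ℕ} (P : Laurent n) {H : ℝ} (hH : ∀ v, ‖P.coeff v‖ ≤ H)
    (x : UnitAddTorus (Fin n)) : ‖eval P (torusPoint x)‖ ≤ numCoeffs P * H := by
  rw [eval_eq_sum, numCoeffs, ← nsmul_eq_mul]
  refine (norm_sum_le _ _).trans (Finset.sum_le_card_nsmul _ _ _ fun v _ => ?_)
  rw [norm_mul, norm_monomialValue_torusPoint, mul_one]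
  exact hH v

theorem norm_sub_le_diam {n : ℕ} (P : Laurent n) {v w : Fin n → ℤ} (hv : v ∈ P.coeff.support)
    (hw : w ∈ P.coeff.support) : ‖v - w‖ ≤ diam P := by
  have hne : {d : ℕ | ∃ b : Fin n → ℝ,
      newtonPolytope P ⊆ Set.Icc b (fun j => b j + (d : ℝ))}.Nonempty := by
    have hfin : ((fun (v : Fin n → ℤ) (j : Fin n) => (v j : ℝ)) ''
        (P.coeff.support : Set (Fin n → ℤ))).Finite := (Finset.finite_toSet _).image _
    obtain ⟨a, ha⟩ := hfin.bddBelow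
    obtain ⟨b, hb⟩ := hfin.bddAbove
    refine ⟨⌈‖b - a‖⌉₊, a, convexHull_min (fun y hy => ⟨ha hy, fun j => ?_⟩) (convex_Icc _ _)⟩
    have h1 : b j - a j ≤ ‖b - a‖ := (le_abs_self _).trans (norm_le_pi_norm (b - a) j)
    have h2 := Nat.le_ceil ‖b - a‖
    have h3 := hb hy j
    linarith
  obtain ⟨b, hb⟩ := Nat.sInf_mem hne
  have hmem : ∀ u ∈ P.coeff.support, (fun j => (u j : ℝ)) ∈
      Set.Icc b (fun j => b j + (diam P : ℝ)) := fun u hu =>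
    hb (subset_convexHull ℝ _ ⟨u, hu, rfl⟩)
  refine (pi_norm_le_iff_of_nonneg (Nat.cast_nonneg _)).2 fun j => ?_
  have h1 := (hmem v hv).1 j
  have h2 := (hmem v hv).2 j
  have h3 := (hmem w hw).1 j
  have h4 := (hmem w hw).2 j
  simp only at h1 h2 h3 h4
  rw [Pi.sub_apply, Int.norm_eq_abs, abs_le]
  push_cast
  constructor <;> linarith

theorem one_le_diam {n : ℕ} (P : Laurent n) (hP : 2 ≤ numCoeffs P) : 1 ≤ diam P := by
  obtain ⟨v, hv, w, hw, hvw⟩ := Finset.one_lt_card.1 (show 1 < P.coeff.support.card from hP)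
  by_contra h
  have h0 : diam P = 0 := by omega
  have h1 := norm_sub_le_diam P hv hw
  rw [h0, Nat.cast_zero] at h1
  exact hvw (sub_eq_zero.1 (norm_le_zero_iff.1 h1))

section Subst

variable {m n : ℕ} (P : Laurent n) (A : Matrix (Fin m) (Fin n) ℤ)

theorem coeff_subst_mulVec (hA : Set.InjOn A.mulVec P.coeff.support) {v : Fin n → ℤ}
    (hv : v ∈ P.coeff.support) : (subst P A).coeff (A.mulVec v) = P.coeff v := by
  rw [subst, AddMonoidAlgebra.coeff_mapDomain]
  exact Finsupp.mapDomain_apply' _ _ subset_rfl hA hv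

theorem support_coeff_subst (hA : Set.InjOn A.mulVec P.coeff.support) :
    (subst P A).coeff.support = P.coeff.support.image A.mulVec := by
  rw [subst, AddMonoidAlgebra.coeff_mapDomain]
  exact Finsupp.mapDomain_support_of_injOn _ hA

theorem numCoeffs_subst (hA : Set.InjOn A.mulVec P.coeff.support) :
    numCoeffs (subst P A) = numCoeffs P := by
  rw [numCoeffs, support_coeff_subst P A hA, Finset.card_image_of_injOn hA, numCoeffs]

end Subst

end MahlerSubst

/-! ### Comparison of Mahler measures -/

namespace MahlerSubst

/-- Smoothing `log |P|` to `log (|P| ^ 2 + ε ^ 2) / 2` changes its integral by at most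
`20 k ^ 2 (ε / H) ^ (1 / k)`, for `P` with `k + 1` nonzero coefficients, of maximal modulus `H`. -/
theorem integrable_logAbs_and_abs_mahler_sub_le {n k : ℕ} (hk : 1 ≤ k) (P : Laurent n)
    (hP : numCoeffs P = k + 1) {v₀ : Fin n → ℤ} (hv₀ : v₀ ∈ P.coeff.support)
    (hmax : ∀ v, ‖P.coeff v‖ ≤ ‖P.coeff v₀‖) {ε : ℝ} (hε : 0 < ε) :
    Integrable (logAbs P) volume ∧
      |mahler P - ∫ x : UnitAddTorus (Fin n), 1 / 2 * Real.log (‖eval P (torusPoint x)‖ ^ 2 + ε ^ 2)| ≤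
        20 * (k : ℝ) ^ 2 * (ε / ‖P.coeff v₀‖) ^ (1 / (k : ℝ)) := by
  set H := ‖P.coeff v₀‖ with hHdef
  have hH : 0 < H := norm_pos_iff.2 (Finsupp.mem_support_iff.1 hv₀)
  have hk1 : (1 : ℝ) ≤ k := by exact_mod_cast hk
  have hk0 : (0 : ℝ) < k := by linarith
  have hμ : ∀ s, 0 < s → volume {x : UnitAddTorus (Fin n) | ‖eval P (torusPoint x)‖ < s} ≤
      ENNReal.ofReal (5 * k * H⁻¹ ^ (1 / (k : ℝ)) * s ^ (1 / (k : ℝ))) := by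
    intro s hs
    rw [mul_assoc, ← Real.mul_rpow (inv_nonneg.2 hH.le) hs.le, inv_mul_eq_div]
    rcases le_or_gt (s / H) 1 with h1 | h1
    · have := volume_norm_eval_lt P hP hv₀ (div_pos hs hH) h1
      rwa [← hHdef, div_mul_cancel₀ _ hH.ne'] at this
    · refine prob_le_one.trans ?_
      rw [ENNReal.one_le_ofReal]
      have := Real.one_le_rpow h1.le (show 0 ≤ 1 / (k : ℝ) by positivity)
      nlinarith
  obtain ⟨h1, h2⟩ := integrable_log_and_abs_sub_le (continuous_eval_torusPoint P).norm.measurable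
    (fun _ => norm_nonneg _) (norm_eval_torusPoint_le P hmax) (by positivity)
    (show 0 < 1 / (k : ℝ) by positivity) (by rw [div_le_one hk0]; exact hk1) hε hμ
  refine ⟨h1, h2.trans (le_of_eq ?_)⟩
  rw [div_eq_inv_mul ε H, Real.mul_rpow (inv_nonneg.2 hH.le) hε.le]
  field_simp
  norm_num

theorem abs_integral_sub_polynomial_le {n : ℕ} (P : Laurent n) {ε δ M : ℝ} (hε : 0 < ε)
    {Q : Polynomial ℝ} (hM : ∀ x, ‖eval P (torusPoint x)‖ ≤ M)
    (hQ : ∀ u, 0 ≤ u → u ≤ M ^ 2 → |1 / 2 * Real.log (u + ε ^ 2) - Q.eval u| ≤ δ) :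
    |(∫ x : UnitAddTorus (Fin n), 1 / 2 * Real.log (‖eval P (torusPoint x)‖ ^ 2 + ε ^ 2)) -
      ∫ x : UnitAddTorus (Fin n), Q.eval (‖eval P (torusPoint x)‖ ^ 2)| ≤ δ := by
  have hc : Continuous fun x : UnitAddTorus (Fin n) => ‖eval P (torusPoint x)‖ ^ 2 :=
    (continuous_eval_torusPoint P).norm.pow 2
  have hint : ∀ f : UnitAddTorus (Fin n) → ℝ, Continuous f → Integrable f volume := fun f hf =>
    hf.integrable_of_hasCompactSupport (HasCompactSupport.of_compactSpace _)
  have hlogc : Continuous fun x : UnitAddTorus (Fin n) =>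
      1 / 2 * Real.log (‖eval P (torusPoint x)‖ ^ 2 + ε ^ 2) :=
    continuous_const.mul ((hc.add continuous_const).log fun x => ne_of_gt (show
      0 < ‖eval P (torusPoint x)‖ ^ 2 + ε ^ 2 by positivity))
  have hQc : Continuous fun x : UnitAddTorus (Fin n) => Q.eval (‖eval P (torusPoint x)‖ ^ 2) :=
    Q.continuous.comp hc
  rw [← integral_sub (hint _ hlogc) (hint _ hQc)]
  have := norm_integral_le_of_norm_le_const (μ := (volume : Measure (UnitAddTorus (Fin n))))
    (f := fun x => 1 / 2 * Real.log (‖eval P (torusPoint x)‖ ^ 2 + ε ^ 2) -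
      Q.eval (‖eval P (torusPoint x)‖ ^ 2)) (C := δ)
    (Eventually.of_forall fun x => hQ _ (by positivity)
      (pow_le_pow_left₀ (norm_nonneg _) (hM x) 2))
  simpa using this

/-- The degree `N` is the largest with `N d < R`, and the Chebyshev parameter `r = 1 - 2 log R / N`
makes the approximation error `r ^ (N + 1) / (1 - r)` smaller than `1 / R`. The second expression is
the corresponding ratio `ε / H` of the smoothing parameter to the largest coefficient. -/
theorem exists_chebyshev_parameters {k : ℕ} (hk : 1 ≤ k) {d R : ℝ} (hd1 : 1 ≤ d)
    (hR2 : 7 * d ^ 2 ≤ R) (hR3 : Real.exp (10 * k) ≤ R) :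
    ∃ (N : ℕ) (r : ℝ), N * d < R ∧ 0 < r ∧ r < 1 ∧ r ^ (N + 1) / (1 - r) ≤ 1 / R ∧
      (((k : ℝ) + 1) * (1 - r) / (2 * √r)) ^ (1 / (k : ℝ)) ≤
        8 * Real.log R * (d / R) ^ (1 / (k : ℝ)) := by
  have hk1 : (1 : ℝ) ≤ k := by exact_mod_cast hk
  have hk0 : (0 : ℝ) < k := by linarith
  have hR0 : 0 < R := (Real.exp_pos _).trans_le hR3
  set L := Real.log R with hL
  have hLk : 10 * k ≤ L := (Real.le_log_iff_exp_le hR0).2 hR3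
  have hL10 : 10 ≤ L := by linarith
  have hRL : R = Real.exp L := (Real.exp_log hR0).symm
  have hRL2 : 8 * L ^ 2 ≤ R := by
    have h1 := Real.pow_div_factorial_le_exp L (by linarith) 5
    rw [← hRL] at h1
    norm_num [Nat.factorial] at h1
    have h2 : (10 : ℝ) ^ 3 ≤ L ^ 3 := pow_le_pow_left₀ (by norm_num) hL10 3
    have h3 : L ^ 5 = L ^ 3 * L ^ 2 := by ring
    nlinarith [sq_nonneg L]
  obtain ⟨N, hN⟩ : ∃ N, ⌈R / d⌉₊ = N + 1 :=
    ⟨⌈R / d⌉₊ - 1, by have : 0 < ⌈R / d⌉₊ := Nat.ceil_pos.2 (by positivity)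
                      omega⟩
  have hNR : (N : ℝ) * d < R := by
    rw [← lt_div_iff₀ (by linarith)]
    exact Nat.lt_ceil.1 (by omega)
  have hN' : R / d ≤ N + 1 := by
    have := Nat.le_ceil (R / d)
    rw [hN] at this
    exact_mod_cast this
  have hRN : R ≤ N * (2 * d) := by
    rw [div_le_iff₀ (by linarith)] at hN'
    nlinarith
  have hN0 : (0 : ℝ) < N := by
    by_contra h
    nlinarith
  set η := 2 * L / N with hη
  have hη0 : 0 < η := by positivity
  have hηR : η ≤ 4 * d * L / R := by
    rw [hη, div_le_div_iff₀ hN0 hR0]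
    nlinarith
  have hη1 : η ≤ 3 / 4 := by
    refine hηR.trans ?_
    rw [div_le_iff₀ hR0]
    refine le_of_sq_le_sq ?_ (by positivity)
    have h1 : (7 * d ^ 2) * (8 * L ^ 2) ≤ R * R := mul_le_mul hR2 hRL2 (by positivity) hR0.le
    nlinarith
  set r := 1 - η with hr
  have hr0 : 0 < r := by linarith
  have hr1 : r < 1 := by linarith
  have hδ : r ^ (N + 1) / (1 - r) ≤ 1 / R := by
    have h1 : r ^ (N + 1) ≤ r ^ N := pow_le_pow_of_le_one hr0.le hr1.le (Nat.le_succ N)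
    have h2 : r ^ N ≤ (R * R)⁻¹ := by
      have h3 : r ≤ Real.exp (-η) := by
        have := Real.add_one_le_exp (-η)
        linarith
      calc r ^ N ≤ Real.exp (-η) ^ N := pow_le_pow_left₀ hr0.le h3 N
        _ = Real.exp (-(L + L)) := by
            rw [← Real.exp_nat_mul]; congr 1; rw [hη]; field_simp; ring
        _ = (R * R)⁻¹ := by rw [Real.exp_neg, Real.exp_add, ← hRL]
    have h4 : 1 - r = η := by rw [hr]; ring
    rw [h4, div_le_div_iff₀ hη0 hR0]
    have h5 : 1 / R ≤ η := by
      rw [hη, div_le_div_iff₀ hR0 hN0]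
      nlinarith
    calc r ^ (N + 1) * R ≤ (R * R)⁻¹ * R := by gcongr; exact h1.trans h2
      _ = 1 / R := by field_simp
      _ ≤ 1 * η := by rw [one_mul]; exact h5
  set X := (d / R) ^ (1 / (k : ℝ)) with hX
  have hεX : (((k : ℝ) + 1) * (1 - r) / (2 * √r)) ^ (1 / (k : ℝ)) ≤ 8 * L * X := by
    have hα : 0 ≤ 1 / (k : ℝ) := by positivity
    have hα1 : 1 / (k : ℝ) ≤ 1 := by rw [div_le_one hk0]; exact hk1
    have hsr : 1 / 2 ≤ √r := Real.le_sqrt_of_sq_le (by norm_num; linarith)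
    have h1 : ((k : ℝ) + 1) * (1 - r) / (2 * √r) ≤ ((k : ℝ) + 1) * (4 * L) * (d / R) := by
      rw [hr, sub_sub_cancel, div_le_iff₀ (by positivity)]
      have h3 : ((k : ℝ) + 1) * η ≤ ((k : ℝ) + 1) * (4 * L) * (d / R) := by
        rw [mul_assoc]
        refine mul_le_mul_of_nonneg_left (hηR.trans (le_of_eq ?_)) (by positivity)
        ring
      have h4 : 0 ≤ ((k : ℝ) + 1) * (4 * L) * (d / R) := by positivity
      nlinarith
    have h5 : ((k : ℝ) + 1) ^ (1 / (k : ℝ)) ≤ 2 := by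
      have h6 : (k : ℝ) + 1 ≤ (2 : ℝ) ^ (k : ℝ) := by
        rw [Real.rpow_natCast]
        have := Nat.lt_two_pow_self (n := k)
        exact_mod_cast this
      calc ((k : ℝ) + 1) ^ (1 / (k : ℝ)) ≤ ((2 : ℝ) ^ (k : ℝ)) ^ (1 / (k : ℝ)) :=
            Real.rpow_le_rpow (by positivity) h6 hα
        _ = 2 := by rw [← Real.rpow_mul (by norm_num), mul_one_div_cancel hk0.ne', Real.rpow_one]
    have h7 : (4 * L) ^ (1 / (k : ℝ)) ≤ 4 * L := by
      calc (4 * L) ^ (1 / (k : ℝ)) ≤ (4 * L) ^ (1 : ℝ) :=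
            Real.rpow_le_rpow_of_exponent_le (by linarith) hα1
        _ = 4 * L := Real.rpow_one _
    calc (((k : ℝ) + 1) * (1 - r) / (2 * √r)) ^ (1 / (k : ℝ)) ≤ (((k : ℝ) + 1) * (4 * L) * (d / R)) ^ (1 / (k : ℝ)) :=
          Real.rpow_le_rpow (by positivity) h1 hα
      _ = ((k : ℝ) + 1) ^ (1 / (k : ℝ)) * (4 * L) ^ (1 / (k : ℝ)) * X := by
          rw [Real.mul_rpow (by positivity) (by positivity),
            Real.mul_rpow (by positivity) (by positivity)]
      _ ≤ 2 * (4 * L) * X := by gcongr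
      _ = 8 * L * X := by ring
  exact ⟨N, r, hNR, hr0, hr1, hδ, hεX⟩

/-- The comparison at a real threshold `R` below which the kernel of `A` has no nonzero integral
vector. -/
theorem abs_mahler_subst_sub_le {m n k : ℕ} (hk : 1 ≤ k) (P : Laurent n)
    (hP : numCoeffs P = k + 1) (A : Matrix (Fin m) (Fin n) ℤ) {R : ℝ}
    (hA : ∀ v, v ≠ 0 → A.mulVec v = 0 → R ≤ ‖v‖) (hR1 : (diam P : ℝ) + 1 ≤ R)
    (hR2 : 7 * (diam P : ℝ) ^ 2 ≤ R) (hR3 : Real.exp (10 * k) ≤ R) :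
    subst P A ≠ 0 ∧ Integrable (logAbs P) volume ∧ Integrable (logAbs (subst P A)) volume ∧
      |mahler (subst P A) - mahler P| ≤
        33 * k * Real.log R ^ 2 * ((diam P : ℝ) / R) ^ (1 / (k : ℝ)) := by
  have hk1 : (1 : ℝ) ≤ k := by exact_mod_cast hk
  have hk0 : (0 : ℝ) < k := by linarith
  set d : ℝ := (diam P : ℝ) with hd
  have hd1 : 1 ≤ d := by rw [hd]; exact_mod_cast one_le_diam P (by omega)
  have hR0 : 0 < R := (Real.exp_pos _).trans_le hR3
  set L := Real.log R with hL
  have hLk : 10 * k ≤ L := (Real.le_log_iff_exp_le hR0).2 hR3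
  have hL10 : 10 ≤ L := by linarith
  -- the substitution is injective on the support
  have hinj : Set.InjOn A.mulVec P.coeff.support := by
    intro v hv w hw hvw
    by_contra hne
    have h1 := hA (v - w) (sub_ne_zero.2 hne) (by rw [Matrix.mulVec_sub]; exact sub_eq_zero.2 hvw)
    have h2 := norm_sub_le_diam P hv hw
    linarith
  have hP' : numCoeffs (subst P A) = k + 1 := (numCoeffs_subst P A hinj).trans hP
  obtain ⟨v₀, hv₀, hmax₀⟩ := Finset.exists_max_image P.coeff.support (fun v => ‖P.coeff v‖)
    (Finset.card_pos.1 (by rw [← numCoeffs, hP]; omega))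
  set H := ‖P.coeff v₀‖ with hHdef
  have hH : 0 < H := norm_pos_iff.2 (Finsupp.mem_support_iff.1 hv₀)
  have hmax : ∀ v, ‖P.coeff v‖ ≤ H := by
    intro v
    by_cases hv : v ∈ P.coeff.support
    · exact hmax₀ v hv
    · rw [Finsupp.notMem_support_iff.1 hv, norm_zero]; exact hH.le
  have hw₀ : A.mulVec v₀ ∈ (subst P A).coeff.support := by
    rw [support_coeff_subst P A hinj]; exact Finset.mem_image_of_mem _ hv₀
  have hH' : ‖(subst P A).coeff (A.mulVec v₀)‖ = H := by rw [coeff_subst_mulVec P A hinj hv₀]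
  have hmax' : ∀ w, ‖(subst P A).coeff w‖ ≤ H := by
    intro w
    by_cases hw : w ∈ (subst P A).coeff.support
    · rw [support_coeff_subst P A hinj] at hw
      obtain ⟨v, hv, rfl⟩ := Finset.mem_image.1 hw
      rw [coeff_subst_mulVec P A hinj hv]
      exact hmax v
    · rw [Finsupp.notMem_support_iff.1 hw, norm_zero]; exact hH.le
  obtain ⟨N, r, hNR, hr0, hr1, hδ, hεX⟩ := exists_chebyshev_parameters hk hd1 hR2 hR3
  set M := ((k : ℝ) + 1) * H with hM
  have hM0 : 0 < M := by positivity
  set ε := M * (1 - r) / (2 * √r) with hε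
  have hr1' : 0 < 1 - r := by linarith
  have hsr : 0 < √r := Real.sqrt_pos.2 hr0
  have hε0 : 0 < ε := by positivity
  have hεH : ((k : ℝ) + 1) * (1 - r) / (2 * √r) = ε / H := by
    rw [hε, hM]
    field_simp
  rw [hεH] at hεX
  obtain ⟨Q, hQdeg, hQ⟩ := exists_polynomial_approx_log hr0 hr1 hM0 N
  set X := (d / R) ^ (1 / (k : ℝ)) with hX
  have hRX : 1 / R ≤ X := by
    have h1 : d / R ≤ 1 := by rw [div_le_one hR0]; linarith
    calc 1 / R ≤ d / R := by gcongr
      _ = (d / R) ^ (1 : ℝ) := (Real.rpow_one _).symm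
      _ ≤ X := Real.rpow_le_rpow_of_exponent_ge (by positivity) h1
          (by rw [div_le_one hk0]; exact hk1)
  -- assembling the estimates
  obtain ⟨hi, he⟩ := integrable_logAbs_and_abs_mahler_sub_le hk P hP hv₀ hmax hε0
  obtain ⟨hi', he'⟩ := integrable_logAbs_and_abs_mahler_sub_le hk (subst P A) hP' hw₀
    (by rw [hH']; exact hmax') hε0
  rw [hH'] at he'
  have hMb := norm_eval_torusPoint_le P hmax
  have hMb' := norm_eval_torusPoint_le (subst P A) hmax'
  rw [hP] at hMb
  rw [hP'] at hMb'
  push_cast at hMb hMb'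
  have hq := (abs_integral_sub_polynomial_le P hε0 hMb hQ).trans hδ
  have hq' := (abs_integral_sub_polynomial_le (subst P A) hε0 hMb' hQ).trans hδ
  rw [integral_polynomial_norm_sq_subst P A (fun v hv w hw => norm_sub_le_diam P hv hw)
    (fun v hv hv' => hNR.trans_le (hA v hv hv')) hQdeg] at hq'
  refine ⟨?_, hi, hi', ?_⟩
  · intro h
    rw [h] at hP'
    simp [numCoeffs] at hP'
  · have h20 : 20 * (k : ℝ) ^ 2 * (ε / H) ^ (1 / (k : ℝ)) ≤ 16 * k * L ^ 2 * X := by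
      have hX0 : 0 ≤ X := by positivity
      calc 20 * (k : ℝ) ^ 2 * (ε / H) ^ (1 / (k : ℝ)) ≤ 20 * (k : ℝ) ^ 2 * (8 * L * X) := by gcongr
        _ = 16 * k * L * X * (10 * k) := by ring
        _ ≤ 16 * k * L * X * L := by gcongr
        _ = 16 * k * L ^ 2 * X := by ring
    have h2 : 2 * (1 / R) ≤ k * L ^ 2 * X := by
      have hX0 : 0 < 1 / R := by positivity
      have h3 : 2 ≤ k * L ^ 2 := by nlinarith
      exact mul_le_mul h3 hRX hX0.le (by positivity)
    rw [abs_le] at he he' hq hq' ⊢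
    constructor <;> linarith [he.1, he.2, he'.1, he'.2, hq.1, hq.2, hq'.1, hq'.2]

end MahlerSubst

theorem theorem4p1 (k n : ℕ) (hk : 2 ≤ k) (hn : 2 ≤ n)
    (P : MahlerSubst.Laurent n) (hP : MahlerSubst.numCoeffs P = k)
    (m : ℕ) (hm : 1 ≤ m) (A : Matrix (Fin m) (Fin n) ℤ)
    (hA : ENNReal.ofReal (MahlerSubst.rhoZero P) ≤ MahlerSubst.rho A) :
    -- both Mahler measures are those of nonzero polynomials, given by convergent integrals
    MahlerSubst.subst P A ≠ 0 ∧
    Integrable (MahlerSubst.logAbs P) volume ∧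
    Integrable (MahlerSubst.logAbs (MahlerSubst.subst P A)) volume ∧
    -- the bound, when `A` has a nontrivial kernel
    (MahlerSubst.rho A ≠ ⊤ →
      |MahlerSubst.mahler (MahlerSubst.subst P A) - MahlerSubst.mahler P| ≤
        8 * (36 * Real.exp 1 * (k : ℝ)) ^ (n - 1) * Real.log (MahlerSubst.rho A).toReal ^ n *
          ((MahlerSubst.diam P : ℝ) / (MahlerSubst.rho A).toReal) ^ (1 / ((k : ℝ) - 1))) ∧
    -- the bound, when `ρ(A) = ∞` and its right-hand side is read as the limit value `0`
    (MahlerSubst.rho A = ⊤ →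
      MahlerSubst.mahler (MahlerSubst.subst P A) = MahlerSubst.mahler P) := by

  obtain ⟨κ, rfl⟩ : ∃ κ, k = κ + 1 := ⟨k - 1, by omega⟩
  have hκ : 1 ≤ κ := by omega
  have hκ1 : (1 : ℝ) ≤ κ := by exact_mod_cast hκ
  have hcast : ((κ + 1 : ℕ) : ℝ) - 1 = κ := by push_cast; ring
  rw [hcast]
  set ρ₀ := MahlerSubst.rhoZero P with hρ₀
  have h1 : (MahlerSubst.diam P : ℝ) + 1 ≤ ρ₀ := le_max_left _ _
  have h2 : 7 * (MahlerSubst.diam P : ℝ) ^ 2 ≤ ρ₀ := (le_max_left _ _).trans (le_max_right _ _)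
  have h3 : Real.exp (10 * κ) ≤ ρ₀ := by
    refine le_trans ?_ ((le_max_right _ _).trans (le_max_right _ _))
    rw [hP, hcast]
    refine Real.exp_le_exp.2 ?_
    have : (5 : ℝ) ≤ max (n : ℝ) 5 := le_max_right _ _
    nlinarith
  have hker : ∀ v, v ≠ 0 → A.mulVec v = 0 → MahlerSubst.rho A ≤ ENNReal.ofReal ‖v‖ :=
    fun v hv hv' => iInf₂_le v ⟨hv, hv'⟩
  have hker₀ : ∀ v, v ≠ 0 → A.mulVec v = 0 → ρ₀ ≤ ‖v‖ := fun v hv hv' =>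
    (ENNReal.ofReal_le_ofReal_iff (norm_nonneg v)).1 (hA.trans (hker v hv hv'))
  obtain ⟨hne, hi, hi', -⟩ := MahlerSubst.abs_mahler_subst_sub_le hκ P hP A hker₀ h1 h2 h3
  refine ⟨hne, hi, hi', fun hfin => ?_, fun htop => ?_⟩
  · set R := (MahlerSubst.rho A).toReal with hR
    have hR₀ : ρ₀ ≤ R := (ENNReal.ofReal_le_iff_le_toReal hfin).1 hA
    obtain ⟨-, -, -, hb⟩ := MahlerSubst.abs_mahler_subst_sub_le hκ P hP A
      (fun v hv hv' => ENNReal.toReal_le_of_le_ofReal (norm_nonneg v) (hker v hv hv'))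
      (h1.trans hR₀) (h2.trans hR₀) (h3.trans hR₀)
    refine hb.trans (mul_le_mul_of_nonneg_right ?_ (by positivity))
    have hL : 1 ≤ Real.log R := by
      rw [Real.le_log_iff_exp_le ((Real.exp_pos _).trans_le (h3.trans hR₀))]
      exact (Real.exp_le_exp.2 (by linarith)).trans (h3.trans hR₀)
    have he : 1 ≤ Real.exp 1 := Real.one_le_exp (by norm_num)
    have hbase : 36 * (κ : ℝ) ≤ 36 * Real.exp 1 * ((κ + 1 : ℕ) : ℝ) := by
      push_cast
      nlinarith
    have hpow : 36 * (κ : ℝ) ≤ (36 * Real.exp 1 * ((κ + 1 : ℕ) : ℝ)) ^ (n - 1) :=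
      hbase.trans (le_self_pow₀ (by linarith) (by omega))
    have hlog : Real.log R ^ 2 ≤ Real.log R ^ n := pow_le_pow_right₀ hL hn
    refine mul_le_mul ?_ hlog (by positivity) (by positivity)
    linarith
  · -- there is no nonzero kernel vector, so every threshold is allowed
    have hinf : ∀ v, v ≠ 0 → A.mulVec v = 0 → False := fun v hv hv' =>
      ENNReal.ofReal_ne_top (top_le_iff.1 (htop ▸ hker v hv hv'))
    have hlim : Tendsto (fun R : ℝ => 33 * (κ : ℝ) * Real.log R ^ 2 *
        ((MahlerSubst.diam P : ℝ) / R) ^ (1 / (κ : ℝ))) atTop (𝓝 0) := by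
      have hα : 0 < 1 / (κ : ℝ) := by positivity
      have h4 := (isLittleO_log_rpow_rpow_atTop 2 hα).tendsto_div_nhds_zero
      have h5 := h4.const_mul (33 * (κ : ℝ) * (MahlerSubst.diam P : ℝ) ^ (1 / (κ : ℝ)))
      rw [mul_zero] at h5
      refine h5.congr' ?_
      filter_upwards [eventually_gt_atTop 0] with R hR
      rw [Real.div_rpow (Nat.cast_nonneg _) hR.le, Real.rpow_two]
      ring
    have h6 : |MahlerSubst.mahler (MahlerSubst.subst P A) - MahlerSubst.mahler P| ≤ 0 := by
      refine ge_of_tendsto hlim ?_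
      filter_upwards [eventually_ge_atTop ρ₀] with R hR
      exact (MahlerSubst.abs_mahler_subst_sub_le hκ P hP A
        (fun v hv hv' => (hinf v hv hv').elim) (h1.trans hR) (h2.trans hR) (h3.trans hR)).2.2.2
    exact sub_eq_zero.1 (abs_nonpos_iff.1 h6)
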